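/- **Setting.** Let $n\ge 3$, let $(\mathcal N,g_{\mathcal N})$ be a compact $(n-1)$-dimensional smooth Riemannian manifold, let $r_H\ge 0$, and let $h\colon(0,\infty)\to\mathbb R$ be smooth with $h>0$ on $(r_H,\infty)$ and $h(r_H)=0$ if $r_H>0$. The spacetime of Class $\mathfrak H$ with metric coefficient $h$ and fibre $\mathcal N$ is $$\mathfrak M=\mathbb R\times(r_H,\infty)\times\mathcal N,\qquad \mathfrak g=-h(r)\,dt^2+\tfrac1{h(r)}\,dr^2+r^2g_{\mathcal N}.$$ If $h$ has finitely many positive zeros and all of them are simple, a generalized Kruskal–Szekeres extension is obtained by gluing blocks $\mathbb P_z\times\mathcal N$, where $z>0$ is a zero of $h$. Let $J_z$ be the interval between the zeros of $h$ neighbouring $z$ (or the ends of $(0,\infty)$), let $C_z=1/h'(z)$, and let $\Phi_z$ be the strictly increasing smooth solution of $\Phi/\Phi'=C_zh$ on $J_z$ with $\Phi'(z)=1$. Then $$\mathbb P_z=\{(u,v)\in\mathbb R^2: uv\in\Phi_z(J_z)\},\qquad \mathfrak g=\frac{2C_z}{\Phi_z'(\rho)}\,(du\otimes dv+dv\otimes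 du)+\rho^2g_{\mathcal N},\qquad \rho=\Phi_z^{-1}(uv).$$ Each quadrant of a block on which $\rho$ runs between two consecutive zeros $z<z'$ of $h$ is glued to exactly one other quadrant, a quadrant $uv>0$ of a block over $z$ to a quadrant $uv<0$ of a block over $z'$, by identifying points with equal $\rho$, equal $t=C\ln|v/u|$ ($C=C_z$ and $C=C_{z'}$ respectively) and the same point of $\mathcal N$. The statement holds for every such gluing pattern. A photon surface with constant umbilicity factor $\lambda\in\mathbb R$ is a smooth immersed timelike hypersurface $\mathcal P^n$ whose second fundamental form $\mathfrak h(X,Y)=-\mathfrak g(\nabla_XY,\eta)$ with respect to a (locally chosen) smooth unit normal $\eta$ equals $\lambda\,\mathfrak p$, where $\mathfrak p$ is the induced metric. **Theorem 5.1.** Let $\mathcal P^n$ be a connected photon surface with constant umbilicity factor $\lambda$ in the spacetime of Class $\mathfrak H$ above or, if all positive zeros of $h$ are simple and finite in number, in a generalized Kruskal–Szekeres extension of it. Assume that the set of radii $r\in(0,\infty)$ such that $$\tfrac12h''(r)+\frac{n-3}{2r}h'(r)-\frac{n-2}{r^2}h(r)+r^{-2}\operatorname{Ric}_{g_{\mathcal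 N}}(X,X)\neq0\quad\text{for all unit tangent vectors } X \text{ of } (\mathcal N,g_{\mathcal N})$$ is dense in $(0,\infty)$. Then at least one of the following holds. 1. $\mathcal P^n$ is rotationally symmetric: at every point of $\mathcal P^n$ the canonical lift of the tangent space of $\mathcal N$ is contained in the tangent space of $\mathcal P^n$, and the unit normal $\eta$ lies in $\operatorname{span}(\partial_t,\partial_r)$, respectively $\operatorname{span}(\partial_u,\partial_v)$. 2. $\mathcal P^n$ is totally geodesic, and its unit normal $\eta$ is parallel ($\nabla_X\eta=0$ for all $X$ tangent to $\mathcal P^n$) and everywhere tangent to $\mathcal N$. -/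

import Mathlib

open scoped Manifold ContDiff Topology

noncomputable section

/-! ## Pseudo-Riemannian geometry in coordinates

`G : W → W →L[ℝ] W →L[ℝ] ℝ` is a metric written in coordinates, and `F : V → W` is the coordinate
expression of a hypersurface. -/

namespace CoordGeom

variable {V W : Type*} [NormedAddCommGroup V] [NormedSpace ℝ V]
  [NormedAddCommGroup W] [NormedSpace ℝ W]

/-- Christoffel symbols of the first kind: the one-form
`u ↦ (∂_v G (w, u) + ∂_w G (v, u) - ∂_u G (v, w)) / 2`. -/
def christoffelFirst (G : W → W →L[ℝ] W →L[ℝ] ℝ) (y v w : W) : W →L[ℝ] ℝ :=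
  (1 / 2 : ℝ) • (fderiv ℝ G y v w + fderiv ℝ G y w v - ((fderiv ℝ G y).flip v).flip w)

/-- Christoffel symbols of the second kind, `Γ(v, w)`: the index is raised with the inverse of the
map `W → W*` given by the (nondegenerate) metric. -/
def christoffel (G : W → W →L[ℝ] W →L[ℝ] ℝ) (y v w : W) : W :=
  (G y).inverse (christoffelFirst G y v w)

/-- The curvature `R(v, w) u = ∇_v ∇_w u - ∇_w ∇_v u` for constant coordinate fields. -/
def riemann (G : W → W →L[ℝ] W →L[ℝ] ℝ) (y v w u : W) : W :=
  fderiv ℝ (fun y' => christoffel G y' w u) y v - fderiv ℝ (fun y' => christoffel G y' v u) y w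
    + christoffel G y v (christoffel G y w u) - christoffel G y w (christoffel G y v u)

/-- The Ricci tensor in coordinates, `Ric(X, Y) = tr (Z ↦ R(Z, X) Y)`. -/
def ricci {m : ℕ}
    (G : EuclideanSpace ℝ (Fin m) →
      EuclideanSpace ℝ (Fin m) →L[ℝ] EuclideanSpace ℝ (Fin m) →L[ℝ] ℝ)
    (y X Y : EuclideanSpace ℝ (Fin m)) : ℝ :=
  ∑ i, (riemann G y (EuclideanSpace.single i 1) X Y) i

/-- `ν` is a smooth unit (spacelike) normal field along `F` near `x₀`. -/
def IsUnitNormalNear (G : W → W →L[ℝ] W →L[ℝ] ℝ) (F : V → W) (x₀ : V) (ν : V → W) : Prop :=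
  ∀ᶠ x in 𝓝 x₀, ContDiffAt ℝ ∞ ν x ∧
    (∀ a, G (F x) (ν x) (fderiv ℝ F x a) = 0) ∧ G (F x) (ν x) (ν x) = 1

/-- The second fundamental form `-G(∇_a (F_* b), ν)` of `F` with respect to `ν`, at `x`. -/
def secondFF (G : W → W →L[ℝ] W →L[ℝ] ℝ) (F ν : V → W) (x a b : V) : ℝ :=
  - G (F x) (fderiv ℝ (fun x' => fderiv ℝ F x' b) x a
      + christoffel G (F x) (fderiv ℝ F x a) (fderiv ℝ F x b)) (ν x)

/-- The ambient covariant derivative `∇_a ν` of a vector field `ν` along `F`, at `x`. -/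
def covDeriv (G : W → W →L[ℝ] W →L[ℝ] ℝ) (F ν : V → W) (x a : V) : W :=
  fderiv ℝ ν x a + christoffel G (F x) (fderiv ℝ F x a) (ν x)

/-- Near `x₀`, `F` is a timelike totally umbilic immersed hypersurface with constant umbilicity
factor `lam`: its second fundamental form with respect to a smooth unit normal is `lam` times the
induced metric. -/
def IsTimelikeUmbilicNear (G : W → W →L[ℝ] W →L[ℝ] ℝ) (F : V → W) (x₀ : V) (lam : ℝ) : Prop :=
  (∀ᶠ x in 𝓝 x₀, Function.Injective (fderiv ℝ F x) ∧
    ∃ a, G (F x) (fderiv ℝ F x a) (fderiv ℝ F x a) < 0) ∧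
  ∃ ν : V → W, IsUnitNormalNear G F x₀ ν ∧
    ∀ᶠ x in 𝓝 x₀, ∀ a b,
      secondFF G F ν x a b = lam * G (F x) (fderiv ℝ F x a) (fderiv ℝ F x b)

end CoordGeom

/-! ## The fibre -/

section Fibre

variable {m : ℕ} {N : Type*} [TopologicalSpace N] [ChartedSpace (EuclideanSpace ℝ (Fin m)) N]
  [IsManifold (𝓡 m) ∞ N]

/-- A smooth Riemannian metric on the fibre. -/
abbrev FibreMetric (m : ℕ) (N : Type*) [TopologicalSpace N]
    [ChartedSpace (EuclideanSpace ℝ (Fin m)) N] [IsManifold (𝓡 m) ∞ N] :=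
  Bundle.ContMDiffRiemannianMetric (𝓡 m) ∞ (EuclideanSpace ℝ (Fin m))
    (fun x : N => TangentSpace (𝓡 m) x)

/-- The fibre metric in the chart of `N` around `c`. -/
def FibreMetric.coord (gN : FibreMetric m N) (c : N) (y : EuclideanSpace ℝ (Fin m)) :
    EuclideanSpace ℝ (Fin m) →L[ℝ] EuclideanSpace ℝ (Fin m) →L[ℝ] ℝ :=
  let q : N := (extChartAt (𝓡 m) c).symm y
  let L : EuclideanSpace ℝ (Fin m) →L[ℝ] EuclideanSpace ℝ (Fin m) :=
    mfderiv 𝓘(ℝ, EuclideanSpace ℝ (Fin m)) (𝓡 m) (extChartAt (𝓡 m) c).symm y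
  let B : EuclideanSpace ℝ (Fin m) →L[ℝ] EuclideanSpace ℝ (Fin m) →L[ℝ] ℝ := gN.inner q
  B.bilinearComp L L

/-- The Ricci curvature `Ric(X, X)` of the fibre at `x`, computed in the chart around `x`. -/
def FibreMetric.ric (gN : FibreMetric m N) (x : N) (X : TangentSpace (𝓡 m) x) : ℝ :=
  let X' : EuclideanSpace ℝ (Fin m) :=
    mfderiv (𝓡 m) 𝓘(ℝ, EuclideanSpace ℝ (Fin m)) (extChartAt (𝓡 m) x) x X
  CoordGeom.ricci (gN.coord x) (extChartAt (𝓡 m) x x) X' X'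

/-- The Ricci eigenvalue condition in spacetime dimension `n + 1`: the set of radii at which the
expression is nonzero for all unit tangent vectors of the fibre is dense in `(0, ∞)`. -/
def RicciEigenvalueCondition (n : ℕ) (gN : FibreMetric m N) (h : ℝ → ℝ) : Prop :=
  Set.Ioi (0 : ℝ) ⊆ closure {r : ℝ | 0 < r ∧
    ∀ (x : N) (X : TangentSpace (𝓡 m) x), gN.inner x X X = 1 →
      (1 / 2) * iteratedDeriv 2 h r + ((n : ℝ) - 3) / (2 * r) * deriv h r
        - ((n : ℝ) - 2) / r ^ 2 * h r + (r ^ 2)⁻¹ * gN.ric x X ≠ 0}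

end Fibre

/-! ## The spacetimes -/

/-- A coordinate domain in the plane with a metric and a radius function; it stands for the warped
product `domain × N` with metric `form + radius ^ 2 * g_N`. -/
structure PlanarBlock where
  domain : Set (ℝ × ℝ)
  form : ℝ × ℝ → (ℝ × ℝ) →L[ℝ] (ℝ × ℝ) →L[ℝ] ℝ
  radius : ℝ × ℝ → ℝ

/-- A set `Pt` covered by planar blocks; with a fibre `N` it gives the spacetime `Pt × N`, whose
smooth structure and metric are those of the blocks. -/
structure BlockAtlas where
  Pt : Type
  Idx : Type
  block : Idx → PlanarBlock
  chart : (i : Idx) → (block i).domain → Pt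

/-- `h` is the metric coefficient of a spacetime of Class `𝔥` over `I = (r_H, ∞)`. -/
structure IsMetricCoefficient (h : ℝ → ℝ) (rH : ℝ) : Prop where
  nonneg : 0 ≤ rH
  smooth : ContDiffOn ℝ ∞ h (Set.Ioi 0)
  pos : ∀ r, rH < r → 0 < h r
  root : 0 < rH → h rH = 0

/-- The block `ℝ × (r_H, ∞)` with coordinates `(t, r)` and metric `-h dt² + h⁻¹ dr²`. -/
def staticBlock (h : ℝ → ℝ) (rH : ℝ) : PlanarBlock where
  domain := {x | rH < x.2}
  form x := (-(h x.2)) • (ContinuousLinearMap.fst ℝ ℝ ℝ).smulRight (ContinuousLinearMap.fst ℝ ℝ ℝ)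
    + (h x.2)⁻¹ • (ContinuousLinearMap.snd ℝ ℝ ℝ).smulRight (ContinuousLinearMap.snd ℝ ℝ ℝ)
  radius x := x.2

/-- The spacetime of Class `𝔥`, covered by its single `(t, r)`-block. -/
def staticAtlas (h : ℝ → ℝ) (rH : ℝ) : BlockAtlas where
  Pt := (staticBlock h rH).domain
  Idx := Unit
  block _ := staticBlock h rH
  chart _ x := x

/-- `h` has finitely many positive zeros, all of them simple. -/
def HasSimpleHorizons (h : ℝ → ℝ) : Prop :=
  {r : ℝ | 0 < r ∧ h r = 0}.Finite ∧ ∀ r, 0 < r → h r = 0 → deriv h r ≠ 0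

/-- For a positive zero `z` of `h`, the interval between the neighbouring zeros of `h` (or the ends
of `(0, ∞)`). -/
def horizonInterval (h : ℝ → ℝ) (z : ℝ) : Set ℝ :=
  {r | 0 < r ∧ ∀ s ∈ Set.uIcc z r, h s = 0 → s = z}

/-- `Φ` is the strictly increasing solution of `Φ / Φ' = C h`, `C = 1 / h'(z)`, with `Φ'(z) = 1` on
the interval around the horizon radius `z`. -/
structure IsKruskalPotential (h : ℝ → ℝ) (z : ℝ) (Φ : ℝ → ℝ) : Prop where
  smooth : ContDiffOn ℝ ∞ Φ (horizonInterval h z)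
  strictMono : StrictMonoOn Φ (horizonInterval h z)
  ode : ∀ r ∈ horizonInterval h z, deriv Φ r ≠ 0 ∧ Φ r / deriv Φ r = 1 / deriv h z * h r
  deriv_eq : deriv Φ z = 1

/-- The radius `ρ(u, v) = Φ⁻¹(u v)`. -/
def kruskalRadius (h : ℝ → ℝ) (z : ℝ) (Φ : ℝ → ℝ) (x : ℝ × ℝ) : ℝ :=
  Function.invFunOn Φ (horizonInterval h z) (x.1 * x.2)

/-- The static time `t = C log |v / u|`, off the axes `u v = 0`. -/
def kruskalTime (h : ℝ → ℝ) (z : ℝ) (x : ℝ × ℝ) : ℝ :=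
  1 / deriv h z * Real.log |x.2 / x.1|

/-- The Kruskal–Szekeres block around the horizon radius `z`: the domain `{u v ∈ Im Φ}` with
coordinates `(u, v)` and metric `(F ∘ ρ) (du ⊗ dv + dv ⊗ du)`, `F = 2 C / Φ'`. -/
def kruskalBlock (h : ℝ → ℝ) (z : ℝ) (Φ : ℝ → ℝ) : PlanarBlock where
  domain := {x | x.1 * x.2 ∈ Φ '' horizonInterval h z}
  form x := (2 * (1 / deriv h z) / deriv Φ (kruskalRadius h z Φ x)) •
    ((ContinuousLinearMap.fst ℝ ℝ ℝ).smulRight (ContinuousLinearMap.snd ℝ ℝ ℝ)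
      + (ContinuousLinearMap.snd ℝ ℝ ℝ).smulRight (ContinuousLinearMap.fst ℝ ℝ ℝ))
  radius := kruskalRadius h z Φ

/-- A scheme for gluing Kruskal–Szekeres blocks. In a block with horizon radius `z` the two
quadrants with `u v > 0` are the regions outside the horizon (radius above `z`), and those with
`u v < 0` are the regions inside. A quadrant is named by the sign of `u`. `glue a s b s'` says that
the outer quadrant `s` of `a` is identified with the inner quadrant `s'` of `b`; here the horizon
radii of `a` and `b` are consecutive zeros of `h`. Every quadrant that lies between two horizon
radii is glued to exactly one other quadrant. -/
structure KruskalGluing (h : ℝ → ℝ) where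
  Block : Type
  nonempty : Nonempty Block
  horizon : Block → ℝ
  horizon_pos : ∀ a, 0 < horizon a
  horizon_root : ∀ a, h (horizon a) = 0
  potential : Block → ℝ → ℝ
  potential_spec : ∀ a, IsKruskalPotential h (horizon a) (potential a)
  glue : Block → ℤˣ → Block → ℤˣ → Prop
  glue_adjacent : ∀ a s b s', glue a s b s' →
    horizon a < horizon b ∧ ∀ r ∈ Set.Ioo (horizon a) (horizon b), h r ≠ 0
  glue_unique_inner : ∀ a s b s' c s'', glue a s b s' → glue a s c s'' → b = c ∧ s' = s''
  glue_unique_outer : ∀ a s b s' c s'', glue a s b s' → glue c s'' b s' → a = c ∧ s = s''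
  glue_outer : ∀ a s, (∃ r, horizon a < r ∧ h r = 0) → ∃ b s', glue a s b s'
  glue_inner : ∀ b s', (∃ r, 0 < r ∧ r < horizon b ∧ h r = 0) → ∃ a s, glue a s b s'

namespace KruskalGluing

variable {h : ℝ → ℝ} (K : KruskalGluing h)

/-- The block with label `a`. -/
def block (a : K.Block) : PlanarBlock := kruskalBlock h (K.horizon a) (K.potential a)

/-- Points of glued quadrants are identified if they have the same static coordinates `(t, r)`. -/
def Identified (x y : (a : K.Block) × (K.block a).domain) : Prop :=
  ∃ s s' : ℤˣ, K.glue x.1 s y.1 s' ∧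
    0 < ((s : ℤ) : ℝ) * x.2.1.1 ∧ 0 < ((s : ℤ) : ℝ) * x.2.1.2 ∧
    0 < ((s' : ℤ) : ℝ) * y.2.1.1 ∧ ((s' : ℤ) : ℝ) * y.2.1.2 < 0 ∧
    (K.block x.1).radius x.2.1 = (K.block y.1).radius y.2.1 ∧
    kruskalTime h (K.horizon x.1) x.2.1 = kruskalTime h (K.horizon y.1) y.2.1

/-- The generalized Kruskal–Szekeres extension: the quotient of the disjoint union of the blocks. -/
def atlas : BlockAtlas where
  Pt := Quot K.Identified
  Idx := K.Block
  block := K.block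
  chart a x := Quot.mk _ ⟨a, x⟩

end KruskalGluing

/-! ## Photon surfaces -/

section PhotonSurface

variable {m : ℕ} {N : Type*} [TopologicalSpace N] [ChartedSpace (EuclideanSpace ℝ (Fin m)) N]
  [IsManifold (𝓡 m) ∞ N]

/-- Near `p`, the smooth map `φ` into `block × N` represents `f : P → Pt × N`. -/
def IsLocalLift (n m : ℕ) {N : Type*} [TopologicalSpace N]
    [ChartedSpace (EuclideanSpace ℝ (Fin m)) N] {P : Type*} [TopologicalSpace P]
    [ChartedSpace (EuclideanSpace ℝ (Fin n)) P] (A : BlockAtlas) (f : P → A.Pt × N)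
    (p : P) (i : A.Idx) (φ : P → (ℝ × ℝ) × N) : Prop :=
  ∀ᶠ q in 𝓝 p,
    ContMDiffAt (𝓡 n) (𝓘(ℝ, ℝ × ℝ).prod (𝓡 m)) ∞ φ q ∧
    ∃ hq : (φ q).1 ∈ (A.block i).domain, f q = (A.chart i ⟨(φ q).1, hq⟩, (φ q).2)

/-- The expression of a map `φ : P → (ℝ × ℝ) × N` in the charts of `P` around `p` and of `N` around
`(φ p).2`. -/
def coordMap (n m : ℕ) {N : Type*} [TopologicalSpace N]
    [ChartedSpace (EuclideanSpace ℝ (Fin m)) N] {P : Type*} [TopologicalSpace P]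
    [ChartedSpace (EuclideanSpace ℝ (Fin n)) P] (φ : P → (ℝ × ℝ) × N) (p : P)
    (x : EuclideanSpace ℝ (Fin n)) :
    (ℝ × ℝ) × EuclideanSpace ℝ (Fin m) :=
  let q : P := (extChartAt (𝓡 n) p).symm x
  ((φ q).1, extChartAt (𝓡 m) (φ p).2 (φ q).2)

/-- The warped product metric `form + radius² g_N` of `block × N`, in the block coordinates and the
chart of `N` around `c`. -/
def warpedCoord (b : PlanarBlock) (gN : FibreMetric m N) (c : N)
    (y : (ℝ × ℝ) × EuclideanSpace ℝ (Fin m)) :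
    ((ℝ × ℝ) × EuclideanSpace ℝ (Fin m)) →L[ℝ] ((ℝ × ℝ) × EuclideanSpace ℝ (Fin m)) →L[ℝ] ℝ :=
  (b.form y.1).bilinearComp (ContinuousLinearMap.fst ℝ _ _) (ContinuousLinearMap.fst ℝ _ _)
    + (b.radius y.1) ^ 2 •
      (gN.coord c y.2).bilinearComp (ContinuousLinearMap.snd ℝ _ _) (ContinuousLinearMap.snd ℝ _ _)

/-- `f : P → Pt × N` is a photon surface with constant umbilicity factor `lam`: it is smooth, and
in every block that it meets it is a timelike, totally umbilic immersed hypersurface with factor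
`lam`. -/
def IsPhotonSurface (n : ℕ) {P : Type*} [TopologicalSpace P]
    [ChartedSpace (EuclideanSpace ℝ (Fin n)) P] (A : BlockAtlas) (gN : FibreMetric m N)
    (f : P → A.Pt × N) (lam : ℝ) : Prop :=
  (∀ p : P, ∃ (i : A.Idx) (φ : P → (ℝ × ℝ) × N), IsLocalLift n m A f p i φ) ∧
  ∀ (p : P) (i : A.Idx) (φ : P → (ℝ × ℝ) × N), IsLocalLift n m A f p i φ →
    CoordGeom.IsTimelikeUmbilicNear (warpedCoord (A.block i) gN (φ p).2)
      (coordMap n m φ p) (extChartAt (𝓡 n) p p) lam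

/-- Rotational symmetry: at every point the lift of the tangent space of `N` is contained in the
tangent space of the surface, and every unit normal lies in the plane spanned by the block
coordinate fields (`∂_t, ∂_r` or `∂_u, ∂_v`). -/
def IsRotationallySymmetric (n : ℕ) {P : Type*} [TopologicalSpace P]
    [ChartedSpace (EuclideanSpace ℝ (Fin n)) P] (A : BlockAtlas) (gN : FibreMetric m N)
    (f : P → A.Pt × N) : Prop :=
  ∀ (p : P) (i : A.Idx) (φ : P → (ℝ × ℝ) × N), IsLocalLift n m A f p i φ →
    let x₀ := extChartAt (𝓡 n) p p
    let F := coordMap n m φ p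
    let G := warpedCoord (A.block i) gN (φ p).2
    (∀ X : EuclideanSpace ℝ (Fin m), ((0 : ℝ × ℝ), X) ∈ Set.range (fderiv ℝ F x₀)) ∧
      ∀ ν, CoordGeom.IsUnitNormalNear G F x₀ ν → (ν x₀).2 = 0

/-- At every point, for every smooth unit normal `ν` near it: the second fundamental form vanishes
(the surface is totally geodesic), `ν` is parallel, and `ν` is tangent to `N`. -/
def IsTotallyGeodesicFibreNormal (n : ℕ) {P : Type*} [TopologicalSpace P]
    [ChartedSpace (EuclideanSpace ℝ (Fin n)) P] (A : BlockAtlas) (gN : FibreMetric m N)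
    (f : P → A.Pt × N) : Prop :=
  ∀ (p : P) (i : A.Idx) (φ : P → (ℝ × ℝ) × N), IsLocalLift n m A f p i φ →
    let x₀ := extChartAt (𝓡 n) p p
    let F := coordMap n m φ p
    let G := warpedCoord (A.block i) gN (φ p).2
    ∀ ν, CoordGeom.IsUnitNormalNear G F x₀ ν →
      (∀ a b, CoordGeom.secondFF G F ν x₀ a b = 0) ∧
      (∀ a, CoordGeom.covDeriv G F ν x₀ a = 0) ∧ (ν x₀).1 = 0

end PhotonSurface

end

/-! Both kinds of block are surfaces `(B, gB)` whose radius `ρ` has a gradient `γ` with `∇γ = κ id`,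
`κ = h'(ρ)/2`, and `dρ(γ) = h(ρ)`. `PlanarBlock.IsAdmissible` records this, together with the fact
that `ρ` has at most one critical point; from there on static and Kruskal blocks are treated alike.

On a totally umbilic hypersurface with constant factor `λ` one has `∇ν = λ dF`, so the Codazzi
equation gives `R(X, Y)ν = 0` for all `X, Y` orthogonal to the unit normal `ν`. Suppose that `ν =
(β, τ)` with `β` and `τ` both nonzero and `dρ ≠ 0`. The warped product curvature then splits this
equation. The base part, compared with `R(a, b)γ = dκ(a) b - dκ(b) a`, forces `r h'' = h'`. The
fibre part determines `R(V, τ)τ` for `V` orthogonal to `τ`, and its trace is `Ric = (n - 2)(h - r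
h'/2)` on the unit vector along `τ`. With these two values the Ricci eigenvalue expression is zero
(`ricci_of_mixed_normal`, `IsPhotonSurface.radius_notMem_of_mixed`).

Being mixed is an open condition. Near a mixed point `dρ` cannot vanish identically: the plane
component of `F` would be constant and the fibre component an immersion of an `n`-manifold into an
`(n - 1)`-dimensional space. Where `dρ ≠ 0`, the function `ρ ∘ F` is a submersion, because a
critical point would make `(γ, 0)` normal to the hypersurface. Hence a whole interval of radii is
exceptional, against density. So everywhere `ν` is tangent to the plane or to the fibre
(`IsPhotonSurface.planeTangent_or_fibreTangent`).

Neither case can turn into the other along a connected hypersurface. They are told apart by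
surjectivity of the differential of the `N`-component of `f`, which refers to no block. If `ν` is
always tangent to the plane, the surface is rotationally symmetric. If it is always tangent to the
fibre, the base part of `∇ν = λ dF` gives `λ = 0`. -/

set_option maxSynthPendingDepth 3

noncomputable section

/-! ## Metrics on open sets of a vector space -/

namespace CoordGeom

variable {V W : Type*} [NormedAddCommGroup V] [NormedSpace ℝ V]
  [NormedAddCommGroup W] [NormedSpace ℝ W]

/-- `G` is a smooth nondegenerate symmetric metric on the open set `U`. -/
structure IsMetricOn (G : W → W →L[ℝ] W →L[ℝ] ℝ) (U : Set W) : Prop where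
  isOpen : IsOpen U
  smooth : ∀ y ∈ U, ContDiffAt ℝ ∞ G y
  symm : ∀ y ∈ U, ∀ v w, G y v w = G y w v
  invertible : ∀ y ∈ U, (G y).IsInvertible

/-- The map exchanging the last two arguments of a trilinear map. -/
def flipLast (A : W →L[ℝ] W →L[ℝ] W →L[ℝ] ℝ) : W →L[ℝ] W →L[ℝ] W →L[ℝ] ℝ :=
  ((ContinuousLinearMap.flipₗᵢ ℝ W W ℝ : (W →L[ℝ] W →L[ℝ] ℝ) →L[ℝ] (W →L[ℝ] W →L[ℝ] ℝ))).comp A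

/-- The Christoffel symbols of the second kind as a bilinear map. -/
def christoffelL (G : W → W →L[ℝ] W →L[ℝ] ℝ) (y : W) : W →L[ℝ] W →L[ℝ] W :=
  (ContinuousLinearMap.compL ℝ W (W →L[ℝ] ℝ) W (G y).inverse).comp
    ((1 / 2 : ℝ) • (fderiv ℝ G y + (fderiv ℝ G y).flip - flipLast (fderiv ℝ G y).flip))

theorem christoffelL_apply (G : W → W →L[ℝ] W →L[ℝ] ℝ) (y v w : W) :
    christoffelL G y v w = christoffel G y v w := by
  simp [christoffelL, christoffel, christoffelFirst, flipLast]

namespace IsMetricOn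

variable {G : W → W →L[ℝ] W →L[ℝ] ℝ} {U : Set W}

theorem mem_nhds (hG : IsMetricOn G U) {y : W} (hy : y ∈ U) : U ∈ 𝓝 y := hG.isOpen.mem_nhds hy

theorem differentiableAt (hG : IsMetricOn G U) {y : W} (hy : y ∈ U) : DifferentiableAt ℝ G y :=
  (hG.smooth y hy).differentiableAt (by simp)

theorem eq_of_forall (hG : IsMetricOn G U) {y : W} (hy : y ∈ U) {v w : W}
    (hvw : ∀ u, G y v u = G y w u) : v = w :=
  (hG.invertible y hy).injective (ContinuousLinearMap.ext hvw)

theorem contDiffAt_christoffelL [CompleteSpace W] (hG : IsMetricOn G U) {y : W} (hy : y ∈ U) :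
    ContDiffAt ℝ ∞ (christoffelL G) y := by
  have h1 : ContDiffAt ℝ ∞ (fun y => fderiv ℝ G y) y :=
    (hG.smooth y hy).fderiv_right (by norm_cast)
  have h2 : ContDiffAt ℝ ∞ (fun y => (G y).inverse) y :=
    ((hG.invertible y hy).contDiffAt_map_inverse).comp y (hG.smooth y hy)
  have h3 : ContDiffAt ℝ ∞ (fun y => (fderiv ℝ G y).flip) y :=
    (ContinuousLinearMap.flipₗᵢ ℝ W W (W →L[ℝ] ℝ)).contDiff.contDiffAt.comp y h1
  have h4 : ContDiffAt ℝ ∞ (fun y => flipLast (fderiv ℝ G y).flip) y :=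
    contDiffAt_const.clm_comp h3
  unfold christoffelL
  exact ((ContinuousLinearMap.compL ℝ W (W →L[ℝ] ℝ) W).contDiff.contDiffAt.comp y h2).clm_comp
    (((h1.add h3).sub h4).const_smul _)

theorem metric_christoffel (hG : IsMetricOn G U) {y : W} (hy : y ∈ U) (v w u : W) :
    G y (christoffel G y v w) u = christoffelFirst G y v w u := by
  rw [christoffel, (hG.invertible y hy).self_apply_inverse]

theorem fderiv_metric_symm (hG : IsMetricOn G U) {y : W} (hy : y ∈ U) (v w u : W) :
    fderiv ℝ G y v w u = fderiv ℝ G y v u w := by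
  have h : (fun y' => G y' w u) =ᶠ[𝓝 y] fun y' => G y' u w := by
    filter_upwards [hG.mem_nhds hy] with y' hy' using hG.symm y' hy' w u
  have h1 : ∀ a b : W, fderiv ℝ (fun y' => G y' a b) y v = fderiv ℝ G y v a b := by
    intro a b
    have hd := hG.differentiableAt hy
    have := ((hd.hasFDerivAt.clm_apply (hasFDerivAt_const a y)).clm_apply
      (hasFDerivAt_const b y)).fderiv
    rw [this]; simp
  rw [← h1, ← h1, h.fderiv_eq]

theorem christoffel_comm (hG : IsMetricOn G U) {y : W} (hy : y ∈ U) (v w : W) :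
    christoffel G y v w = christoffel G y w v := by
  refine hG.eq_of_forall hy fun u => ?_
  rw [hG.metric_christoffel hy, hG.metric_christoffel hy]
  simp only [christoffelFirst, one_div, smul_apply,
    sub_apply, add_apply, ContinuousLinearMap.flip_apply]
  rw [hG.fderiv_metric_symm hy u v w]
  ring_nf

/-- Metric compatibility: in the sum of the two Koszul expressions all terms except `∂_v G (w, u)`
cancel. -/
theorem fderiv_metric (hG : IsMetricOn G U) {y : W} (hy : y ∈ U) (v w u : W) :
    fderiv ℝ G y v w u = G y (christoffel G y v w) u + G y w (christoffel G y v u) := by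
  rw [hG.symm y hy w, hG.metric_christoffel hy, hG.metric_christoffel hy]
  simp only [christoffelFirst, one_div, smul_apply,
    sub_apply, add_apply, ContinuousLinearMap.flip_apply,
    smul_eq_mul]
  rw [hG.fderiv_metric_symm hy v u w, hG.fderiv_metric_symm hy u v w,
    hG.fderiv_metric_symm hy w v u]
  ring

/-- The uniqueness of the Levi-Civita connection. -/
theorem christoffel_eq_of (hG : IsMetricOn G U) {y : W} (hy : y ∈ U) {v w x : W}
    (h : ∀ u, G y x u = christoffelFirst G y v w u) : christoffel G y v w = x :=
  hG.eq_of_forall hy fun u => by rw [hG.metric_christoffel hy, h]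

/-- Differentiating the Christoffel symbols as a bilinear-map-valued function makes the trilinearity
of the curvature visible. -/
theorem riemann_eq [CompleteSpace W] (hG : IsMetricOn G U) {y : W} (hy : y ∈ U) (v w u : W) :
    riemann G y v w u = fderiv ℝ (christoffelL G) y v w u - fderiv ℝ (christoffelL G) y w v u
      + christoffelL G y v (christoffelL G y w u) - christoffelL G y w (christoffelL G y v u) := by
  have hd : DifferentiableAt ℝ (christoffelL G) y :=
    (hG.contDiffAt_christoffelL hy).differentiableAt (by simp)
  have h1 : ∀ a b c : W, fderiv ℝ (fun y' => christoffel G y' a b) y c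
      = fderiv ℝ (christoffelL G) y c a b := by
    intro a b c
    simp only [← christoffelL_apply]
    have := ((hd.hasFDerivAt.clm_apply (hasFDerivAt_const a y)).clm_apply
      (hasFDerivAt_const b y)).fderiv
    rw [this]; simp
  simp only [riemann, h1, christoffelL_apply]

theorem riemann_self [CompleteSpace W] (hG : IsMetricOn G U) {y : W} (hy : y ∈ U) (v u : W) :
    riemann G y v v u = 0 := by
  rw [hG.riemann_eq hy]; abel

theorem riemann_smul_right [CompleteSpace W] (hG : IsMetricOn G U) {y : W} (hy : y ∈ U)
    (v w u : W) (c : ℝ) : riemann G y v w (c • u) = c • riemann G y v w u := by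
  simp only [hG.riemann_eq hy, map_smul, smul_add, smul_sub]

/-- The second derivatives of `G(u, u)` commute. Written through Christoffel symbols, their
commutator is twice the left-hand side, since the cross term `G(Γ_v u, Γ_w u)` is symmetric in `v,
w`. -/
theorem metric_riemann_self [CompleteSpace W] (hG : IsMetricOn G U) {y : W} (hy : y ∈ U)
    (v w u : W) : G y (riemann G y v w u) u = 0 := by
  have hd : DifferentiableAt ℝ (christoffelL G) y :=
    (hG.contDiffAt_christoffelL hy).differentiableAt (by simp)
  have hGd := hG.differentiableAt hy
  have key : ∀ a b : W, fderiv ℝ (fun y' => fderiv ℝ G y' a u u) y b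
      = 2 * (G y (christoffelL G y b (christoffelL G y a u)) u
        + G y (christoffelL G y a u) (christoffelL G y b u)
        + G y (fderiv ℝ (christoffelL G) y b a u) u) := by
    intro a b
    have h1 : (fun y' => fderiv ℝ G y' a u u) =ᶠ[𝓝 y]
        fun y' => 2 * G y' (christoffelL G y' a u) u := by
      filter_upwards [hG.mem_nhds hy] with y' hy'
      rw [hG.fderiv_metric hy', hG.symm y' hy' u, christoffelL_apply]; ring
    rw [h1.fderiv_eq]
    have h2 := (((hGd.hasFDerivAt.clm_apply ((hd.hasFDerivAt.clm_apply
      (hasFDerivAt_const a y)).clm_apply (hasFDerivAt_const u y))).clm_apply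
      (hasFDerivAt_const u y)).const_mul 2).fderiv
    rw [h2]
    simp [hG.fderiv_metric hy, christoffelL_apply]
    ring
  have hsm : ContDiffAt ℝ 2 G y := (hG.smooth y hy).of_le (by norm_cast)
  have hs : IsSymmSndFDerivAt ℝ G y := hsm.isSymmSndFDerivAt (by simp)
  have h3 : ∀ a b : W, fderiv ℝ (fun y' => fderiv ℝ G y' a u u) y b
      = fderiv ℝ (fderiv ℝ G) y b a u u := by
    intro a b
    have hd2 : DifferentiableAt ℝ (fderiv ℝ G) y :=
      (hsm.fderiv_right (m := 1) (by norm_num)).differentiableAt (by simp)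
    rw [(((hd2.hasFDerivAt.clm_apply (hasFDerivAt_const a y)).clm_apply
      (hasFDerivAt_const u y)).clm_apply (hasFDerivAt_const u y)).fderiv]
    simp
  have h4 := key w v
  have h5 := key v w
  rw [h3] at h4 h5
  rw [hs.eq v w] at h4
  rw [hG.riemann_eq hy]
  have h6 := hG.symm y hy (christoffelL G y w u) (christoffelL G y v u)
  simp only [map_add, map_sub, add_apply, sub_apply]
  linarith

theorem metric_riemann_antisymm [CompleteSpace W] (hG : IsMetricOn G U) {y : W} (hy : y ∈ U)
    (v w u u' : W) : G y (riemann G y v w u) u' = - G y u (riemann G y v w u') := by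
  have h := hG.metric_riemann_self hy v w (u + u')
  have h1 := hG.metric_riemann_self hy v w u
  have h2 := hG.metric_riemann_self hy v w u'
  have h3 : riemann G y v w (u + u') = riemann G y v w u + riemann G y v w u' := by
    simp only [hG.riemann_eq hy, map_add]; abel
  rw [h3] at h
  simp only [map_add, add_apply] at h
  rw [hG.symm y hy u]
  linarith

/-- The Codazzi equation for a vector field `ν` along `F` with `∇ν = f dF`. -/
theorem riemann_of_covDeriv_eq [CompleteSpace W] (hG : IsMetricOn G U) {F ν : V → W} {f : V → ℝ}
    {x : V} (hx : F x ∈ U) (hF : ContDiffAt ℝ 2 F x) (hν : ContDiffAt ℝ 2 ν x)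
    (hf : DifferentiableAt ℝ f x)
    (h : ∀ᶠ x' in 𝓝 x, ∀ a, covDeriv G F ν x' a = f x' • fderiv ℝ F x' a) (a b : V) :
    riemann G (F x) (fderiv ℝ F x a) (fderiv ℝ F x b) (ν x)
      = fderiv ℝ f x a • fderiv ℝ F x b - fderiv ℝ f x b • fderiv ℝ F x a := by
  have hd : DifferentiableAt ℝ (christoffelL G) (F x) :=
    (hG.contDiffAt_christoffelL hx).differentiableAt (by simp)
  have hF1 : DifferentiableAt ℝ F x := hF.differentiableAt (by simp)
  have hν1 : DifferentiableAt ℝ ν x := hν.differentiableAt (by simp)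
  have hF2 : DifferentiableAt ℝ (fderiv ℝ F) x :=
    (hF.fderiv_right (m := 1) (by norm_num)).differentiableAt (by simp)
  have hν2 : DifferentiableAt ℝ (fderiv ℝ ν) x :=
    (hν.fderiv_right (m := 1) (by norm_num)).differentiableAt (by simp)
  -- The hypothesis for direction `a`, differentiated along `b`. Antisymmetrizing in `a, b` removes
  -- the second derivatives of `F` and `ν` and leaves the curvature.
  have key : ∀ a b : V, fderiv ℝ (fderiv ℝ ν) x b a
      + (fderiv ℝ (christoffelL G) (F x) (fderiv ℝ F x b) (fderiv ℝ F x a) (ν x)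
        + christoffelL G (F x) (fderiv ℝ (fderiv ℝ F) x b a) (ν x)
        + christoffelL G (F x) (fderiv ℝ F x a) (fderiv ℝ ν x b))
      = fderiv ℝ f x b • fderiv ℝ F x a + f x • fderiv ℝ (fderiv ℝ F) x b a := by
    intro a b
    have h1 : (fun x' => fderiv ℝ ν x' a + christoffelL G (F x') (fderiv ℝ F x' a) (ν x'))
        =ᶠ[𝓝 x] fun x' => f x' • fderiv ℝ F x' a := by
      filter_upwards [h] with x' hx'
      rw [← hx' a, covDeriv, christoffelL_apply]
    have h2 := (((hν2.hasFDerivAt.clm_apply (hasFDerivAt_const a x))).add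
      (((hd.hasFDerivAt.comp x hF1.hasFDerivAt).clm_apply
      (hF2.hasFDerivAt.clm_apply (hasFDerivAt_const a x))).clm_apply hν1.hasFDerivAt)).fderiv
    have h3 := (hf.hasFDerivAt.smul (hF2.hasFDerivAt.clm_apply (hasFDerivAt_const a x))).fderiv
    have h4 := congrArg (fun L : V →L[ℝ] W => L b) h1.fderiv_eq
    have h5 := congrArg (fun L : V →L[ℝ] W => L b) h2
    have h6 := congrArg (fun L : V →L[ℝ] W => L b) h3
    simp only [Function.comp_def, Pi.add_def] at h4 h5 h6
    rw [h5] at h4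
    replace h4 := h4.trans h6
    simp at h4
    rw [add_comm (fderiv ℝ f x b • fderiv ℝ F x a), ← h4]
    abel
  have hsF : IsSymmSndFDerivAt ℝ F x := hF.isSymmSndFDerivAt (by simp)
  have hsν : IsSymmSndFDerivAt ℝ ν x := hν.isSymmSndFDerivAt (by simp)
  have h0 := h.self_of_nhds
  have ha : fderiv ℝ ν x a = f x • fderiv ℝ F x a - christoffelL G (F x) (fderiv ℝ F x a) (ν x) := by
    rw [← h0 a, covDeriv, christoffelL_apply]; abel
  have hb : fderiv ℝ ν x b = f x • fderiv ℝ F x b - christoffelL G (F x) (fderiv ℝ F x b) (ν x) := by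
    rw [← h0 b, covDeriv, christoffelL_apply]; abel
  have k1 := key b a
  have k2 := key a b
  rw [ha] at k1
  rw [hb] at k2
  rw [hsF.eq b a, hsν.eq b a] at k2
  have hc : christoffelL G (F x) (fderiv ℝ F x b) (fderiv ℝ F x a)
      = christoffelL G (F x) (fderiv ℝ F x a) (fderiv ℝ F x b) := by
    simp only [christoffelL_apply, hG.christoffel_comm hx (fderiv ℝ F x b)]
  have k3 := congrArg₂ (· - ·) k1 k2
  simp only [map_sub, map_smul, hc] at k3
  rw [hG.riemann_eq hx]
  rw [← sub_eq_zero] at k3 ⊢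
  rw [← k3]
  abel

/-- The Levi-Civita connection along a map is metric. -/
theorem fderiv_metric_along (hG : IsMetricOn G U) {F A B : V → W} {x : V} (hx : F x ∈ U)
    (hF : DifferentiableAt ℝ F x) (hA : DifferentiableAt ℝ A x) (hB : DifferentiableAt ℝ B x)
    (a : V) : fderiv ℝ (fun x' => G (F x') (A x') (B x')) x a
      = G (F x) (covDeriv G F A x a) (B x) + G (F x) (A x) (covDeriv G F B x a) := by
  have h1 := ((((hG.differentiableAt hx).hasFDerivAt.comp x hF.hasFDerivAt).clm_apply
    hA.hasFDerivAt).clm_apply hB.hasFDerivAt).fderiv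
  have h2 := congrArg (fun L : V →L[ℝ] ℝ => L a) h1
  simp only [Function.comp_def] at h2
  rw [h2]
  simp [hG.fderiv_metric hx, covDeriv]
  ring

/-- The Weingarten equation, from differentiating `G(ν, dF b) = 0`. -/
theorem metric_covDeriv_tangent (hG : IsMetricOn G U) {F ν : V → W} {x : V} (hx : F x ∈ U)
    (hF : ContDiffAt ℝ 2 F x) (hν : IsUnitNormalNear G F x ν) (a b : V) :
    G (F x) (covDeriv G F ν x a) (fderiv ℝ F x b) = secondFF G F ν x a b := by
  have hF2 : DifferentiableAt ℝ (fderiv ℝ F) x :=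
    (hF.fderiv_right (m := 1) (by norm_num)).differentiableAt (by simp)
  have h1 := hG.fderiv_metric_along hx (hF.differentiableAt (by simp))
    (hν.self_of_nhds.1.differentiableAt (by simp))
    (hF2.clm_apply (differentiableAt_const b)) a
  have h2 : (fun x' => G (F x') (ν x') (fderiv ℝ F x' b)) =ᶠ[𝓝 x] fun _ => 0 := by
    filter_upwards [hν] with x' hx' using hx'.2.1 b
  rw [h2.fderiv_eq] at h1
  simp only [fderiv_fun_const, Pi.zero_apply, zero_apply] at h1
  rw [secondFF, hG.symm _ hx _ (ν x)]
  simp only [covDeriv] at h1 ⊢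
  linarith

theorem metric_covDeriv_self (hG : IsMetricOn G U) {F ν : V → W} {x : V} (hx : F x ∈ U)
    (hF : DifferentiableAt ℝ F x) (hν : IsUnitNormalNear G F x ν) (a : V) :
    G (F x) (covDeriv G F ν x a) (ν x) = 0 := by
  have hd := hν.self_of_nhds.1.differentiableAt (by simp)
  have h1 := hG.fderiv_metric_along hx hF hd hd a
  have h2 : (fun x' => G (F x') (ν x') (ν x')) =ᶠ[𝓝 x] fun _ => 1 := by
    filter_upwards [hν] with x' hx' using hx'.2.2
  rw [h2.fderiv_eq, hG.symm _ hx (ν x)] at h1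
  simp only [fderiv_fun_const, Pi.zero_apply, zero_apply] at h1
  linarith

/-- The tangent space of a hypersurface is the orthogonal complement of a normal vector. -/
theorem exists_of_normal [FiniteDimensional ℝ V] [FiniteDimensional ℝ W] (hG : IsMetricOn G U)
    (hdim : Module.finrank ℝ W = Module.finrank ℝ V + 1) {y : W} (hy : y ∈ U) {T : V →L[ℝ] W}
    (hT : Function.Injective T) {ν : W} (hν : ν ≠ 0) (hνT : ∀ a, G y ν (T a) = 0) {w : W}
    (hw : G y ν w = 0) : ∃ a, T a = w := by
  have hle : LinearMap.range (T : V →ₗ[ℝ] W) ≤ LinearMap.ker (G y ν : W →ₗ[ℝ] ℝ) := by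
    rintro _ ⟨a, rfl⟩
    exact hνT a
  have hne : (G y ν : W →ₗ[ℝ] ℝ) ≠ 0 := by
    intro h0
    refine hν (hG.eq_of_forall hy fun u => ?_)
    simpa using LinearMap.congr_fun h0 u
  have h1 : Module.finrank ℝ (LinearMap.range (T : V →ₗ[ℝ] W)) = Module.finrank ℝ V :=
    LinearMap.finrank_range_of_inj hT
  have h2 := Module.Dual.finrank_ker_add_one_of_ne_zero hne
  have h3 := Submodule.eq_of_le_of_finrank_eq hle (by omega)
  have h4 : w ∈ LinearMap.ker (G y ν : W →ₗ[ℝ] ℝ) := hw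
  rw [← h3] at h4
  exact h4

/-- Every test vector is a tangent vector plus a multiple of `ν`, so these pairings determine a
vector. -/
theorem eq_of_tangent_of_normal [FiniteDimensional ℝ V] [FiniteDimensional ℝ W]
    (hG : IsMetricOn G U) (hdim : Module.finrank ℝ W = Module.finrank ℝ V + 1) {y : W}
    (hy : y ∈ U) {T : V →L[ℝ] W} (hT : Function.Injective T) {ν : W} (hν : G y ν ν = 1)
    (hνT : ∀ a, G y ν (T a) = 0) {v w : W} (h1 : ∀ b, G y v (T b) = G y w (T b))
    (h2 : G y v ν = G y w ν) : v = w := by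
  have hν0 : ν ≠ 0 := by
    rintro rfl
    simp at hν
  refine hG.eq_of_forall hy fun u => ?_
  obtain ⟨a, ha⟩ := hG.exists_of_normal hdim hy hT hν0 hνT (w := u - G y ν u • ν)
    (by simp [hν])
  have h3 := h1 a
  rw [ha] at h3
  simp only [map_sub, map_smul, smul_eq_mul, h2] at h3
  linarith

/-- On a totally umbilic hypersurface the unit normal satisfies `∇ν = λ dF`. -/
theorem covDeriv_eq_of_umbilic [FiniteDimensional ℝ V] [FiniteDimensional ℝ W]
    (hG : IsMetricOn G U) (hdim : Module.finrank ℝ W = Module.finrank ℝ V + 1) {F ν : V → W}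
    {x : V} {lam : ℝ} (hx : F x ∈ U) (hF : ContDiffAt ℝ 2 F x)
    (hinj : Function.Injective (fderiv ℝ F x)) (hν : IsUnitNormalNear G F x ν)
    (hII : ∀ a b, secondFF G F ν x a b = lam * G (F x) (fderiv ℝ F x a) (fderiv ℝ F x b)) (a : V) :
    covDeriv G F ν x a = lam • fderiv ℝ F x a := by
  have h0 := hν.self_of_nhds
  refine hG.eq_of_tangent_of_normal hdim hx hinj h0.2.2 h0.2.1 (fun b => ?_) ?_
  · rw [hG.metric_covDeriv_tangent hx hF hν, hII]
    simp
  · rw [hG.metric_covDeriv_self hx (hF.differentiableAt (by simp)) hν]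
    have := h0.2.1 a
    rw [hG.symm _ hx] at this
    simp [this]

end IsMetricOn

end CoordGeom

/-! ### Warped products and their Levi-Civita connection -/

namespace CoordGeom

theorem isInvertible_of_nondegenerate {W : Type*} [NormedAddCommGroup W] [NormedSpace ℝ W]
    [FiniteDimensional ℝ W] {A : W →L[ℝ] W →L[ℝ] ℝ} (h : ∀ v, (∀ w, A v w = 0) → v = 0) :
    A.IsInvertible := by
  have hinj : Function.Injective A := by
    refine (injective_iff_map_eq_zero A).2 fun v hv => h v fun w => ?_
    rw [hv]; rfl
  have hfin : Module.finrank ℝ W = Module.finrank ℝ (W →L[ℝ] ℝ) := by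
    rw [← (LinearMap.toContinuousLinearMap (𝕜 := ℝ) (E := W) (F' := ℝ)).finrank_eq]
    exact (Subspace.dual_finrank_eq (K := ℝ) (V := W)).symm
  have hinj' : Function.Injective (A : W →ₗ[ℝ] W →L[ℝ] ℝ) := hinj
  refine ⟨(LinearEquiv.ofInjectiveOfFinrankEq (A : W →ₗ[ℝ] W →L[ℝ] ℝ) hinj'
    hfin).toContinuousLinearEquiv, ?_⟩
  ext v w
  rfl

/-- Precomposition in both arguments is two rounds of composing with `L` and flipping, each smooth
in the form. -/
theorem contDiffAt_bilinearComp {W B : Type*} [NormedAddCommGroup W] [NormedSpace ℝ W]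
    [NormedAddCommGroup B] [NormedSpace ℝ B] {g : W → B →L[ℝ] B →L[ℝ] ℝ} {y : W}
    (hg : ContDiffAt ℝ ∞ g y) (L : W →L[ℝ] B) :
    ContDiffAt ℝ ∞ (fun y' => (g y').bilinearComp L L) y := by
  have h1 : ContDiffAt ℝ ∞ (fun y' => ((g y').comp L).flip) y :=
    (ContinuousLinearMap.flipₗᵢ ℝ W B ℝ).contDiff.contDiffAt.comp y (hg.clm_comp contDiffAt_const)
  have h2 : ContDiffAt ℝ ∞ (fun y' => (((g y').comp L).flip.comp L).flip) y :=
    (ContinuousLinearMap.flipₗᵢ ℝ W W ℝ).contDiff.contDiffAt.comp y (h1.clm_comp contDiffAt_const)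
  exact h2

theorem fderiv_apply_apply {W X : Type*} [NormedAddCommGroup W] [NormedSpace ℝ W]
    [NormedAddCommGroup X] [NormedSpace ℝ X] {A : W → X →L[ℝ] X →L[ℝ] ℝ} {y : W}
    (hA : DifferentiableAt ℝ A y) (a b : X) (v : W) :
    fderiv ℝ (fun y' => A y' a b) y v = fderiv ℝ A y v a b := by
  rw [((hA.hasFDerivAt.clm_apply (hasFDerivAt_const a y)).clm_apply
    (hasFDerivAt_const b y)).fderiv]
  simp

variable {B E : Type*} [NormedAddCommGroup B] [NormedSpace ℝ B]
  [NormedAddCommGroup E] [NormedSpace ℝ E]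

/-- `γ` is the gradient of the positive function `ρ` on `U`, and `∇γ = κ id`. -/
structure IsWarpingData (gB : B → B →L[ℝ] B →L[ℝ] ℝ) (ρ : B → ℝ) (γ : B → B) (κ : B → ℝ)
    (U : Set B) : Prop where
  metric : IsMetricOn gB U
  smooth_radius : ∀ y ∈ U, ContDiffAt ℝ ∞ ρ y
  radius_pos : ∀ y ∈ U, 0 < ρ y
  smooth_grad : ∀ y ∈ U, ContDiffAt ℝ ∞ γ y
  metric_grad : ∀ y ∈ U, ∀ w, gB y (γ y) w = fderiv ℝ ρ y w
  covDeriv_grad : ∀ y ∈ U, ∀ v, fderiv ℝ γ y v + christoffel gB y v (γ y) = κ y • v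

/-- The warped product metric. -/
def warped (gB : B → B →L[ℝ] B →L[ℝ] ℝ) (ρ : B → ℝ) (gE : E → E →L[ℝ] E →L[ℝ] ℝ) (y : B × E) :
    (B × E) →L[ℝ] (B × E) →L[ℝ] ℝ :=
  (gB y.1).bilinearComp (ContinuousLinearMap.fst ℝ _ _) (ContinuousLinearMap.fst ℝ _ _)
    + (ρ y.1) ^ 2 •
      (gE y.2).bilinearComp (ContinuousLinearMap.snd ℝ _ _) (ContinuousLinearMap.snd ℝ _ _)

theorem warped_apply (gB : B → B →L[ℝ] B →L[ℝ] ℝ) (ρ : B → ℝ) (gE : E → E →L[ℝ] E →L[ℝ] ℝ)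
    (y v w : B × E) :
    warped gB ρ gE y v w = gB y.1 v.1 w.1 + (ρ y.1) ^ 2 * gE y.2 v.2 w.2 := by
  simp [warped]

namespace IsWarpingData

variable {gB : B → B →L[ℝ] B →L[ℝ] ℝ} {ρ : B → ℝ} {γ : B → B} {κ : B → ℝ} {U : Set B}
  {gE : E → E →L[ℝ] E →L[ℝ] ℝ} {O : Set E}

theorem differentiableAt_radius (hw : IsWarpingData gB ρ γ κ U) {y : B} (hy : y ∈ U) :
    DifferentiableAt ℝ ρ y := (hw.smooth_radius y hy).differentiableAt (by simp)

theorem isMetricOn_warped [FiniteDimensional ℝ B] [FiniteDimensional ℝ E]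
    (hw : IsWarpingData gB ρ γ κ U) (hE : IsMetricOn gE O) :
    IsMetricOn (warped gB ρ gE) (U ×ˢ O) where
  isOpen := hw.metric.isOpen.prod hE.isOpen
  smooth := by
    rintro y ⟨h1, h2⟩
    have hB := (hw.metric.smooth _ h1).comp y contDiffAt_fst
    have hE' := (hE.smooth _ h2).comp y contDiffAt_snd
    have hρ := (hw.smooth_radius _ h1).comp y contDiffAt_fst
    exact (contDiffAt_bilinearComp hB _).add ((hρ.pow 2).smul (contDiffAt_bilinearComp hE' _))
  symm := by
    rintro y ⟨h1, h2⟩ v w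
    rw [warped_apply, warped_apply, hw.metric.symm _ h1, hE.symm _ h2]
  invertible := by
    rintro y ⟨h1, h2⟩
    refine isInvertible_of_nondegenerate fun v hv => ?_
    have hρ := (hw.radius_pos _ h1).ne'
    refine Prod.ext (hw.metric.eq_of_forall h1 fun u => ?_) (hE.eq_of_forall h2 fun u => ?_)
    · simpa [warped_apply] using hv (u, 0)
    · simpa [warped_apply, hρ] using hv (0, u)

theorem fderiv_warped [FiniteDimensional ℝ B] [FiniteDimensional ℝ E]
    (hw : IsWarpingData gB ρ γ κ U) (hE : IsMetricOn gE O) {y : B × E} (hy : y ∈ U ×ˢ O)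
    (v w u : B × E) : fderiv ℝ (warped gB ρ gE) y v w u = fderiv ℝ gB y.1 v.1 w.1 u.1
      + (2 * ρ y.1 * fderiv ℝ ρ y.1 v.1 * gE y.2 w.2 u.2
        + (ρ y.1) ^ 2 * fderiv ℝ gE y.2 v.2 w.2 u.2) := by
  rw [← fderiv_apply_apply ((hw.isMetricOn_warped hE).differentiableAt hy)]
  simp only [warped_apply]
  have h1 : HasFDerivAt (fun y' : B × E => gB y'.1) _ y :=
    (hw.metric.differentiableAt hy.1).hasFDerivAt.comp y hasFDerivAt_fst
  have h2 : HasFDerivAt (fun y' : B × E => gE y'.2) _ y :=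
    (hE.differentiableAt hy.2).hasFDerivAt.comp y hasFDerivAt_snd
  have h3 : HasFDerivAt (fun y' : B × E => ρ y'.1) _ y :=
    (hw.differentiableAt_radius hy.1).hasFDerivAt.comp y hasFDerivAt_fst
  have h4 := ((h1.clm_apply (hasFDerivAt_const w.1 y)).clm_apply (hasFDerivAt_const u.1 y)).add
    ((h3.pow 2).mul ((h2.clm_apply (hasFDerivAt_const w.2 y)).clm_apply
      (hasFDerivAt_const u.2 y)))
  have h5 := congrArg (fun L : B × E →L[ℝ] ℝ => L v) h4.fderiv
  refine Eq.trans h5 ?_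
  simp
  ring

/-- By uniqueness of the connection it suffices to lower the index. The terms beyond the product
connection come from the derivative of `ρ²`; raising the index of `dρ` produces `γ`. -/
theorem christoffel_warped [FiniteDimensional ℝ B] [FiniteDimensional ℝ E]
    (hw : IsWarpingData gB ρ γ κ U) (hE : IsMetricOn gE O) {y : B × E} (hy : y ∈ U ×ˢ O)
    (v w : B × E) : christoffel (warped gB ρ gE) y v w =
      (christoffel gB y.1 v.1 w.1 - (ρ y.1 * gE y.2 v.2 w.2) • γ y.1,
        christoffel gE y.2 v.2 w.2 + ((ρ y.1)⁻¹ * fderiv ℝ ρ y.1 v.1) • w.2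
          + ((ρ y.1)⁻¹ * fderiv ℝ ρ y.1 w.1) • v.2) := by
  have hρ := (hw.radius_pos _ hy.1).ne'
  refine (hw.isMetricOn_warped hE).christoffel_eq_of hy fun u => ?_
  rw [warped_apply]
  simp only [christoffelFirst, one_div, smul_apply, sub_apply, add_apply,
    ContinuousLinearMap.flip_apply, smul_eq_mul, hw.fderiv_warped hE hy, map_sub, map_add, map_smul,
    hw.metric.metric_christoffel hy.1, hE.metric_christoffel hy.2, hw.metric_grad _ hy.1]
  rw [hE.symm _ hy.2 w.2 u.2]
  field_simp
  ring

end IsWarpingData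

end CoordGeom

/-! ### Curvature of a warped product -/

namespace CoordGeom

variable {B E : Type*} [NormedAddCommGroup B] [NormedSpace ℝ B]
  [NormedAddCommGroup E] [NormedSpace ℝ E]

namespace IsWarpingData

variable {gB : B → B →L[ℝ] B →L[ℝ] ℝ} {ρ : B → ℝ} {γ : B → B} {κ : B → ℝ} {U : Set B}
  {gE : E → E →L[ℝ] E →L[ℝ] ℝ} {O : Set E}

/-- The Hessian of the radius is `κ` times the metric. -/
theorem hessian_radius (hw : IsWarpingData gB ρ γ κ U) {y : B} (hy : y ∈ U) (v w : B) :
    fderiv ℝ (fderiv ℝ ρ) y v w = κ y * gB y v w + fderiv ℝ ρ y (christoffel gB y v w) := by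
  have hd : DifferentiableAt ℝ (fderiv ℝ ρ) y :=
    ((hw.smooth_radius y hy).fderiv_right (m := 1) (by norm_cast)).differentiableAt (by simp)
  have hγ : DifferentiableAt ℝ γ y := (hw.smooth_grad y hy).differentiableAt (by simp)
  have h1 : (fun y' => gB y' (γ y') w) =ᶠ[𝓝 y] fun y' => fderiv ℝ ρ y' w := by
    filter_upwards [hw.metric.mem_nhds hy] with y' hy' using hw.metric_grad y' hy' w
  have h2 := congrArg (fun L : B →L[ℝ] ℝ => L v) h1.fderiv_eq
  have h3 := congrArg (fun L : B →L[ℝ] ℝ => L v)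
    (((hw.metric.differentiableAt hy).hasFDerivAt.clm_apply hγ.hasFDerivAt).clm_apply
      (hasFDerivAt_const w y)).fderiv
  have h4 := congrArg (fun L : B →L[ℝ] ℝ => L v)
    (hd.hasFDerivAt.clm_apply (hasFDerivAt_const w y)).fderiv
  have h5 := (h3.symm.trans h2).trans h4
  simp at h5
  have h6 := hw.metric.fderiv_metric hy v (γ y) w
  have h7 := congrArg (fun x => gB y x w) (hw.covDeriv_grad y hy v)
  simp only [map_add, map_smul, add_apply, smul_apply, smul_eq_mul] at h7
  rw [← hw.metric_grad y hy]
  linarith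

theorem fderiv_christoffel_warped [FiniteDimensional ℝ B] [FiniteDimensional ℝ E]
    (hw : IsWarpingData gB ρ γ κ U) (hE : IsMetricOn gE O) {y : B × E} (hy : y ∈ U ×ˢ O)
    (v w u : B × E) : fderiv ℝ (christoffelL (warped gB ρ gE)) y v w u =
      (fderiv ℝ (christoffelL gB) y.1 v.1 w.1 u.1
          - (ρ y.1 * gE y.2 w.2 u.2) • fderiv ℝ γ y.1 v.1
          - (fderiv ℝ ρ y.1 v.1 * gE y.2 w.2 u.2 + ρ y.1 * fderiv ℝ gE y.2 v.2 w.2 u.2) • γ y.1,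
        fderiv ℝ (christoffelL gE) y.2 v.2 w.2 u.2
          + ((ρ y.1)⁻¹ * fderiv ℝ (fderiv ℝ ρ) y.1 v.1 w.1
              - ((ρ y.1) ^ 2)⁻¹ * fderiv ℝ ρ y.1 v.1 * fderiv ℝ ρ y.1 w.1) • u.2
          + ((ρ y.1)⁻¹ * fderiv ℝ (fderiv ℝ ρ) y.1 v.1 u.1
              - ((ρ y.1) ^ 2)⁻¹ * fderiv ℝ ρ y.1 v.1 * fderiv ℝ ρ y.1 u.1) • w.2) := by
  have hρ := (hw.radius_pos _ hy.1).ne'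
  have hW := hw.isMetricOn_warped hE
  have h0 : HasFDerivAt (fun y' => christoffelL (warped gB ρ gE) y' w u) _ y :=
    ((((hW.contDiffAt_christoffelL hy).differentiableAt (by simp)).hasFDerivAt.clm_apply
      (hasFDerivAt_const w y)).clm_apply (hasFDerivAt_const u y))
  have hd : DifferentiableAt ℝ (fderiv ℝ ρ) y.1 :=
    ((hw.smooth_radius _ hy.1).fderiv_right (m := 1) (by norm_cast)).differentiableAt (by simp)
  have hγ : DifferentiableAt ℝ γ y.1 := (hw.smooth_grad _ hy.1).differentiableAt (by simp)
  have d1 : HasFDerivAt (fun y' : B × E => christoffelL gB y'.1) _ y :=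
    ((hw.metric.contDiffAt_christoffelL hy.1).differentiableAt (by simp)).hasFDerivAt.comp y
      hasFDerivAt_fst
  have d2 : HasFDerivAt (fun y' : B × E => christoffelL gE y'.2) _ y :=
    ((hE.contDiffAt_christoffelL hy.2).differentiableAt (by simp)).hasFDerivAt.comp y
      hasFDerivAt_snd
  have d3 : HasFDerivAt (fun y' : B × E => gE y'.2) _ y :=
    (hE.differentiableAt hy.2).hasFDerivAt.comp y hasFDerivAt_snd
  have d4 : HasFDerivAt (fun y' : B × E => ρ y'.1) _ y :=
    (hw.differentiableAt_radius hy.1).hasFDerivAt.comp y hasFDerivAt_fst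
  have d5 : HasFDerivAt (fun y' : B × E => fderiv ℝ ρ y'.1) _ y :=
    hd.hasFDerivAt.comp y hasFDerivAt_fst
  have d6 : HasFDerivAt (fun y' : B × E => γ y'.1) _ y :=
    hγ.hasFDerivAt.comp y hasFDerivAt_fst
  have d7 : HasFDerivAt (fun y' : B × E => (ρ y'.1)⁻¹) _ y :=
    (hasDerivAt_inv hρ).comp_hasFDerivAt y d4
  have hA := (((d1.clm_apply (hasFDerivAt_const w.1 y)).clm_apply (hasFDerivAt_const u.1 y)).sub
    ((d4.mul ((d3.clm_apply (hasFDerivAt_const w.2 y)).clm_apply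
      (hasFDerivAt_const u.2 y))).smul d6))
  have hB := (((d2.clm_apply (hasFDerivAt_const w.2 y)).clm_apply (hasFDerivAt_const u.2 y)).add
    ((d7.mul (d5.clm_apply (hasFDerivAt_const w.1 y))).smul (hasFDerivAt_const u.2 y))).add
    ((d7.mul (d5.clm_apply (hasFDerivAt_const u.1 y))).smul (hasFDerivAt_const w.2 y))
  have hev : (fun y' => christoffelL (warped gB ρ gE) y' w u) =ᶠ[𝓝 y] fun y' =>
      (christoffelL gB y'.1 w.1 u.1 - (ρ y'.1 * gE y'.2 w.2 u.2) • γ y'.1,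
        christoffelL gE y'.2 w.2 u.2 + ((ρ y'.1)⁻¹ * fderiv ℝ ρ y'.1 w.1) • u.2
          + ((ρ y'.1)⁻¹ * fderiv ℝ ρ y'.1 u.1) • w.2) := by
    filter_upwards [hW.mem_nhds hy] with y' hy'
    simp only [christoffelL_apply, hw.christoffel_warped hE hy']
  have h1 := h0.unique ((hA.prodMk hB).congr_of_eventuallyEq hev)
  have h2 := congrArg (fun L : B × E →L[ℝ] B × E => L v) h1
  simp at h2
  refine h2.trans (Prod.ext ?_ ?_)
  · simp only
    module
  · simp only
    module

/-- The curvature of a warped product. -/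
theorem riemann_warped [FiniteDimensional ℝ B] [FiniteDimensional ℝ E]
    (hw : IsWarpingData gB ρ γ κ U) (hE : IsMetricOn gE O) {y : B × E} (hy : y ∈ U ×ˢ O)
    (v w u : B × E) : riemann (warped gB ρ gE) y v w u =
      (riemann gB y.1 v.1 w.1 u.1
          - (ρ y.1 * κ y.1) • (gE y.2 w.2 u.2 • v.1 - gE y.2 v.2 u.2 • w.1),
        riemann gE y.2 v.2 w.2 u.2
          + (κ y.1 / ρ y.1) • (gB y.1 v.1 u.1 • w.2 - gB y.1 w.1 u.1 • v.2)
          - fderiv ℝ ρ y.1 (γ y.1) • (gE y.2 w.2 u.2 • v.2 - gE y.2 v.2 u.2 • w.2)) := by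
  have hρ := (hw.radius_pos _ hy.1).ne'
  rw [(hw.isMetricOn_warped hE).riemann_eq hy, hw.metric.riemann_eq hy.1, hE.riemann_eq hy.2]
  simp only [hw.fderiv_christoffel_warped hE hy]
  simp only [christoffelL_apply, hw.christoffel_warped hE hy]
  simp only [← christoffelL_apply]
  -- This eliminates the derivative of `γ`, and `hessian_radius` eliminates the second derivatives
  -- of `ρ`; only a comparison of coefficients of vectors remains.
  have hc := hw.covDeriv_grad _ hy.1
  have hcv : ∀ a, fderiv ℝ γ y.1 a = κ y.1 • a - christoffelL gB y.1 a (γ y.1) := by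
    intro a
    rw [← hc a, christoffelL_apply]; abel
  refine Prod.ext ?_ ?_
  · simp only [Prod.fst_add, Prod.fst_sub, map_sub, map_add, map_smul, hcv,
      hE.fderiv_metric hy.2, ← christoffelL_apply, smul_eq_mul, mul_add, mul_sub]
    have e1 := hE.symm _ hy.2 w.2 v.2
    have e2 : christoffelL gE y.2 w.2 v.2 = christoffelL gE y.2 v.2 w.2 := by
      simp only [christoffelL_apply, hE.christoffel_comm hy.2 w.2]
    rw [e1, e2]
    match_scalars <;> field_simp <;> ring
  · simp only [Prod.snd_add, Prod.snd_sub, map_sub, map_add, map_smul, hw.hessian_radius hy.1,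
      ← christoffelL_apply, smul_eq_mul, mul_add, mul_sub]
    have e1 := hw.metric.symm _ hy.1 w.1 v.1
    have e2 : christoffelL gE y.2 w.2 v.2 = christoffelL gE y.2 v.2 w.2 := by
      simp only [christoffelL_apply, hE.christoffel_comm hy.2 w.2]
    have e3 : christoffelL gB y.1 w.1 v.1 = christoffelL gB y.1 v.1 w.1 := by
      simp only [christoffelL_apply, hw.metric.christoffel_comm hy.1 w.1]
    rw [e1, e2, e3]
    match_scalars <;> field_simp <;> ring

end IsWarpingData

end CoordGeom

/-! ### The curvature condition at a mixed normal -/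

namespace CoordGeom

namespace IsMetricOn

variable {W : Type*} [NormedAddCommGroup W] [NormedSpace ℝ W] [CompleteSpace W]
  {G : W → W →L[ℝ] W →L[ℝ] ℝ} {U : Set W}

theorem riemann_add_left (hG : IsMetricOn G U) {y : W} (hy : y ∈ U) (v v' w u : W) :
    riemann G y (v + v') w u = riemann G y v w u + riemann G y v' w u := by
  simp only [hG.riemann_eq hy, map_add, add_apply]; abel

theorem riemann_smul_left (hG : IsMetricOn G U) {y : W} (hy : y ∈ U) (v w u : W) (c : ℝ) :
    riemann G y (c • v) w u = c • riemann G y v w u := by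
  simp only [hG.riemann_eq hy, map_smul, smul_apply, smul_sub, smul_add]

theorem riemann_smul_mid (hG : IsMetricOn G U) {y : W} (hy : y ∈ U) (v w u : W) (c : ℝ) :
    riemann G y v (c • w) u = c • riemann G y v w u := by
  simp only [hG.riemann_eq hy, map_smul, smul_apply, smul_sub, smul_add]

end IsMetricOn

/-- If `Z ↦ R(Z, τ) τ` is `c` times the identity on the complement of `τ`, then
`Ric(τ, τ) = (m - 1) c`. -/
theorem ricci_eq_of_orthogonal {m : ℕ}
    {g : EuclideanSpace ℝ (Fin m) →
      EuclideanSpace ℝ (Fin m) →L[ℝ] EuclideanSpace ℝ (Fin m) →L[ℝ] ℝ}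
    {O : Set (EuclideanSpace ℝ (Fin m))} (hg : IsMetricOn g O) {y : EuclideanSpace ℝ (Fin m)}
    (hy : y ∈ O) {τ : EuclideanSpace ℝ (Fin m)} (hτ : g y τ τ ≠ 0) {c : ℝ}
    (h : ∀ V, g y V τ = 0 → riemann g y V τ τ = c • V) :
    ricci g y τ τ = ((m : ℝ) - 1) * c := by
  -- The part of `Z` along `τ` contributes nothing, as `R(τ, τ) = 0`.
  have h1 : ∀ Z, riemann g y Z τ τ = c • (Z - (g y Z τ / g y τ τ) • τ) := by
    intro Z
    rw [← h _ (by simp [hτ])]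
    have h2 : Z = (Z - (g y Z τ / g y τ τ) • τ) + (g y Z τ / g y τ τ) • τ := by abel
    conv_lhs => rw [h2]
    rw [hg.riemann_add_left hy, hg.riemann_smul_left hy, hg.riemann_self hy, smul_zero, add_zero]
  -- The trace of `Z ↦ g(Z, τ) τ`; the projection subtracted in `h1` therefore has trace one.
  have h3 : ∑ i, τ i * g y (EuclideanSpace.single i (1 : ℝ)) τ = g y τ τ := by
    have h4 : τ = ∑ i, τ i • EuclideanSpace.single i (1 : ℝ) := by
      ext j
      simp [Finset.sum_apply, Pi.single_apply]
    have h5 := congrArg (fun Z => g y Z τ) h4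
    simp only [map_sum, map_smul, _root_.sum_apply, smul_apply, smul_eq_mul] at h5
    exact h5.symm
  have h5 : ∀ i : Fin m, (riemann g y (EuclideanSpace.single i 1) τ τ) i
      = c - c / g y τ τ * (τ i * g y (EuclideanSpace.single i (1 : ℝ)) τ) := by
    intro i
    rw [h1]
    simp
    ring
  rw [ricci, Finset.sum_congr rfl fun i _ => h5 i, Finset.sum_sub_distrib, ← Finset.mul_sum, h3]
  simp
  field_simp

/-- A vector annihilated by a given functional on the plane. -/
theorem exists_ne_zero_apply_eq_zero (f : ℝ × ℝ →L[ℝ] ℝ) : ∃ b : ℝ × ℝ, b ≠ 0 ∧ f b = 0 := by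
  by_cases hf : f = 0
  · exact ⟨(1, 0), by simp, by simp [hf]⟩
  have hfe : ∀ b : ℝ × ℝ, f b = b.1 * f (1, 0) + b.2 * f (0, 1) := by
    intro b
    have : b = b.1 • ((1 : ℝ), (0 : ℝ)) + b.2 • ((0 : ℝ), (1 : ℝ)) := by ext <;> simp
    conv_lhs => rw [this]
    simp only [map_add, map_smul, smul_eq_mul]
  refine ⟨(-f (0, 1), f (1, 0)), fun h0 => hf ?_, by rw [hfe]; ring⟩
  have h1 := congrArg Prod.fst h0
  have h2 := congrArg Prod.snd h0
  simp only [Prod.fst_zero, Prod.snd_zero, neg_eq_zero] at h1 h2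
  ext <;> simp [h1, h2]

theorem exists_eq_smul_of_apply_eq_zero {f : ℝ × ℝ →L[ℝ] ℝ} (hf : f ≠ 0) {a b : ℝ × ℝ}
    (hb : b ≠ 0) (hfa : f a = 0) (hfb : f b = 0) : ∃ c : ℝ, a = c • b := by
  have h1 := Module.Dual.finrank_ker_add_one_of_ne_zero (f := (f : ℝ × ℝ →ₗ[ℝ] ℝ))
    (fun h => hf (ContinuousLinearMap.coe_injective h))
  have h2 : Module.finrank ℝ (LinearMap.ker (f : ℝ × ℝ →ₗ[ℝ] ℝ)) = 1 := by
    simp at h1; simpa using h1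
  obtain ⟨c, hc⟩ := (finrank_eq_one_iff_of_nonzero' (⟨b, hfb⟩ : LinearMap.ker (f : ℝ × ℝ →ₗ[ℝ] ℝ))
    (fun h => hb (congrArg Subtype.val h))).1 h2 ⟨a, hfa⟩
  exact ⟨c, (congrArg Subtype.val hc).symm⟩

namespace IsWarpingData

variable {B E : Type*} [NormedAddCommGroup B] [NormedSpace ℝ B] [CompleteSpace B]
  [NormedAddCommGroup E] [NormedSpace ℝ E]
  {ρ : B → ℝ} {γ : B → B} {κ : B → ℝ} {U : Set B} {gB : B → B →L[ℝ] B →L[ℝ] ℝ}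

/-- The Codazzi-type identity along the identity map, with `γ` as the vector field. -/
theorem riemann_grad (hw : IsWarpingData gB ρ γ κ U) {y : B} (hy : y ∈ U)
    (hκ : DifferentiableAt ℝ κ y) (v w : B) :
    riemann gB y v w (γ y) = fderiv ℝ κ y v • w - fderiv ℝ κ y w • v := by
  have h := hw.metric.riemann_of_covDeriv_eq (F := fun x : B => x) (ν := γ) (f := κ) hy
    contDiffAt_id ((hw.smooth_grad y hy).of_le (by norm_cast)) hκ (by
      filter_upwards [hw.metric.mem_nhds hy] with y' hy' a
      simp [covDeriv, hw.covDeriv_grad y' hy']) v w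
  simpa using h

end IsWarpingData

section Mixed

variable {m : ℕ} {gB : ℝ × ℝ → (ℝ × ℝ) →L[ℝ] (ℝ × ℝ) →L[ℝ] ℝ} {ρ : ℝ × ℝ → ℝ}
  {γ : ℝ × ℝ → ℝ × ℝ} {κ : ℝ × ℝ → ℝ} {U : Set (ℝ × ℝ)}
  {gE : EuclideanSpace ℝ (Fin m) →
    EuclideanSpace ℝ (Fin m) →L[ℝ] EuclideanSpace ℝ (Fin m) →L[ℝ] ℝ}
  {O : Set (EuclideanSpace ℝ (Fin m))}

/-- If a vector `ν` with nonzero components satisfies `R(X, Y) ν = 0` for all `X, Y` orthogonal to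
it, then the warping function and the Ricci curvature of the fibre are tied to each other. -/
theorem ricci_of_mixed_normal (hw : IsWarpingData gB ρ γ κ U) (hE : IsMetricOn gE O)
    {y : (ℝ × ℝ) × EuclideanSpace ℝ (Fin m)} (hy : y ∈ U ×ˢ O)
    (hpos : ∀ X, X ≠ 0 → 0 < gE y.2 X X) {κ' : ℝ} (hκ : HasFDerivAt κ (κ' • fderiv ℝ ρ y.1) y.1)
    (hdρ : fderiv ℝ ρ y.1 ≠ 0) {ν : (ℝ × ℝ) × EuclideanSpace ℝ (Fin m)}
    (hν1 : ν.1 ≠ 0) (hν2 : ν.2 ≠ 0)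
    (hR : ∀ X Y, warped gB ρ gE y ν X = 0 → warped gB ρ gE y ν Y = 0 →
      riemann (warped gB ρ gE) y X Y ν = 0) :
    κ' * ρ y.1 = κ y.1 ∧ ∃ X, gE y.2 X X = 1 ∧
      ricci gE y.2 X X = ((m : ℝ) - 1) * (fderiv ℝ ρ y.1 (γ y.1) - κ y.1 * ρ y.1) := by
  obtain ⟨β, τ⟩ := ν
  simp only at hν1 hν2
  have hρ := (hw.radius_pos _ hy.1).ne'
  have hgB0 : ∀ a, a ≠ 0 → gB y.1 a ≠ 0 := by
    intro a ha h0
    exact ha ((hw.metric.invertible _ hy.1).injective (by rw [h0, map_zero]))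
  have hγ0 : γ y.1 ≠ 0 := by
    intro h0
    refine hdρ (ContinuousLinearMap.ext fun u => ?_)
    rw [← hw.metric_grad _ hy.1, h0]; simp
  set s := gE y.2 τ τ with hs
  have hspos : 0 < s := hpos τ hν2
  obtain ⟨b, hb, hβb⟩ := exists_ne_zero_apply_eq_zero (gB y.1 β)
  -- This value makes `(a, τ)` orthogonal to `ν`: it cancels the fibre contribution `ρ² s`. No norm
  -- of `β` is divided by, since `β` may be null.
  obtain ⟨a, ha⟩ : ∃ a, gB y.1 β a = -((ρ y.1) ^ 2 * s) := by
    obtain ⟨a, ha⟩ : ∃ a, gB y.1 β a ≠ 0 := by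
      by_contra! h0
      exact hgB0 β hν1 (ContinuousLinearMap.ext h0)
    exact ⟨(-((ρ y.1) ^ 2 * s) / gB y.1 β a) • a, by simp [ha]⟩
  have hX : warped gB ρ gE y (β, τ) (a, τ) = 0 := by
    rw [warped_apply]; simp only; rw [ha, ← hs]; ring
  have hY : warped gB ρ gE y (β, τ) (b, 0) = 0 := by
    rw [warped_apply]; simp [hβb]
  have hsB := hw.metric.symm _ hy.1
  have hab : gB y.1 a β = -((ρ y.1) ^ 2 * s) := by rw [hsB, ha]
  have hbβ : gB y.1 b β = 0 := by rw [hsB, hβb]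
  have h1 := congrArg Prod.fst (hR _ _ hX hY)
  rw [hw.riemann_warped hE hy] at h1
  simp only [map_zero, zero_apply, zero_smul, zero_sub, ← hs, Prod.fst_zero, smul_neg,
    sub_neg_eq_add] at h1
  have hRb : riemann gB y.1 a b β = -((ρ y.1 * κ y.1) • s • b) := eq_neg_of_add_eq_zero_left h1
  have hRγ := hw.riemann_grad hy.1 hκ.differentiableAt a b
  rw [hκ.fderiv] at hRγ
  simp only [smul_apply, smul_eq_mul] at hRγ
  have hfirst : κ' * ρ y.1 = κ y.1 := by
    -- If `dρ(b) = 0`, then `γ` and `β` are both orthogonal to `b`, hence parallel, and the two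
    -- formulas for `R(a, b)` compare directly. Otherwise skew-adjointness of `R(a, b)` relates
    -- them.
    by_cases hρb : fderiv ℝ ρ y.1 b = 0
    · obtain ⟨c, hc⟩ := exists_eq_smul_of_apply_eq_zero (hgB0 b hb) hν1 (a := γ y.1) (b := β)
        (by rw [hsB, hw.metric_grad _ hy.1, hρb]) hbβ
      have hc0 : c ≠ 0 := by
        rintro rfl
        exact hγ0 (by rw [hc, zero_smul])
      have hρa : fderiv ℝ ρ y.1 a = c * -((ρ y.1) ^ 2 * s) := by
        rw [← hw.metric_grad _ hy.1, hc]; simp [ha]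
      rw [hc, hw.metric.riemann_smul_right hy.1, hRb, hρb, hρa, mul_zero, zero_smul, sub_zero,
        smul_neg, smul_smul, smul_smul, ← neg_smul] at hRγ
      have h2 := smul_left_injective ℝ hb hRγ
      have h3 : c * (ρ y.1 * s) * (κ' * ρ y.1) = c * (ρ y.1 * s) * κ y.1 := by
        linarith
      exact mul_left_cancel₀ (by positivity) h3
    · have h2 := hw.metric.metric_riemann_antisymm hy.1 a b β (γ y.1)
      rw [hRγ, hRb] at h2
      simp only [map_neg, map_smul, map_sub, neg_apply, smul_apply, smul_eq_mul, ha, hβb] at h2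
      rw [hsB b, hw.metric_grad _ hy.1] at h2
      have h3 : (ρ y.1 * s * fderiv ℝ ρ y.1 b) * (κ' * ρ y.1)
          = (ρ y.1 * s * fderiv ℝ ρ y.1 b) * κ y.1 := by linarith
      exact mul_left_cancel₀ (by positivity) h3
  refine ⟨hfirst, (√s)⁻¹ • τ, ?_, ?_⟩
  · simp only [map_smul, smul_apply, smul_eq_mul, ← hs]
    rw [← mul_assoc, ← mul_inv, Real.mul_self_sqrt hspos.le, inv_mul_cancel₀ hspos.ne']
  · have ht : (√s)⁻¹ * ((√s)⁻¹ * s) = 1 := by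
      rw [← mul_assoc, ← mul_inv, Real.mul_self_sqrt hspos.le, inv_mul_cancel₀ hspos.ne']
    refine ricci_eq_of_orthogonal hE hy.2 ?_ fun V hV => ?_
    · simp only [map_smul, smul_apply, smul_eq_mul, ← hs, ht]
      exact one_ne_zero
    · have hVτ : gE y.2 V τ = 0 := by
        have hs0 := (Real.sqrt_pos.2 hspos).ne'
        simpa [hs0] using hV
      have hτV : gE y.2 τ V = 0 := by rw [hE.symm _ hy.2, hVτ]
      have hZ : warped gB ρ gE y (β, τ) (0, V) = 0 := by
        rw [warped_apply]; simp [hτV]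
      -- The base part `a` of `X` enters only through `gB(a, β) = -ρ² s`, which turns the mixed
      -- curvature coefficient `κ / ρ` into `κ ρ s`.
      have h2 := congrArg Prod.snd (hR _ _ hZ hX)
      rw [hw.riemann_warped hE hy] at h2
      simp only [map_zero, zero_apply, zero_smul, zero_sub, ← hs, Prod.snd_zero, hVτ, hab,
        sub_zero] at h2
      rw [hE.riemann_smul_mid hy.2, hE.riemann_smul_right hy.2]
      have h3 : riemann gE y.2 V τ τ = (fderiv ℝ ρ y.1 (γ y.1) * s - κ y.1 * ρ y.1 * s) • V := by
        rw [sub_eq_zero] at h2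
        rw [eq_sub_of_add_eq h2]
        match_scalars
        field_simp
      rw [h3, smul_smul, smul_smul]
      congr 1
      linear_combination (fderiv ℝ ρ y.1 (γ y.1) - κ y.1 * ρ y.1) * ht

end Mixed

end CoordGeom

/-! ### Admissible blocks: the gradient criterion and the static block -/

namespace CoordGeom

/-- A gradient field `γ` with `L_γ g = 2 κ g` satisfies `∇γ = κ id`. -/
theorem covDeriv_grad_of_lieDeriv {B : Type*} [NormedAddCommGroup B] [NormedSpace ℝ B]
    {gB : B → B →L[ℝ] B →L[ℝ] ℝ} {ρ : B → ℝ} {γ : B → B} {U : Set B} (hg : IsMetricOn gB U)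
    {y : B} (hy : y ∈ U) (hρ : ContDiffAt ℝ ∞ ρ y) (hγ : DifferentiableAt ℝ γ y)
    (hgrad : ∀ y ∈ U, ∀ w, gB y (γ y) w = fderiv ℝ ρ y w) {κ : ℝ}
    (hL : ∀ v w, fderiv ℝ gB y (γ y) v w + gB y (fderiv ℝ γ y v) w + gB y v (fderiv ℝ γ y w)
      = 2 * κ * gB y v w) (v : B) :
    fderiv ℝ γ y v + christoffel gB y v (γ y) = κ • v := by
  have hd : DifferentiableAt ℝ (fderiv ℝ ρ) y :=
    (hρ.fderiv_right (m := 1) (by norm_cast)).differentiableAt (by simp)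
  have hsymm : IsSymmSndFDerivAt ℝ ρ y :=
    (hρ.of_le (m := 2) (by norm_cast)).isSymmSndFDerivAt (by simp)
  -- The Hessian of `ρ` is symmetric, so `∇γ` is self-adjoint and is determined by its symmetric
  -- part, half the Lie derivative of the metric.
  have key : ∀ v w, fderiv ℝ (fderiv ℝ ρ) y v w
      = fderiv ℝ gB y v (γ y) w + gB y (fderiv ℝ γ y v) w := by
    intro v w
    have h1 : (fun y' => gB y' (γ y') w) =ᶠ[𝓝 y] fun y' => fderiv ℝ ρ y' w := by
      filter_upwards [hg.mem_nhds hy] with y' hy' using hgrad y' hy' w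
    have h2 := congrArg (fun L : B →L[ℝ] ℝ => L v) h1.fderiv_eq
    have h3 := congrArg (fun L : B →L[ℝ] ℝ => L v)
      (((hg.differentiableAt hy).hasFDerivAt.clm_apply hγ.hasFDerivAt).clm_apply
        (hasFDerivAt_const w y)).fderiv
    have h4 := congrArg (fun L : B →L[ℝ] ℝ => L v)
      (hd.hasFDerivAt.clm_apply (hasFDerivAt_const w y)).fderiv
    have h5 := (h3.symm.trans h2).trans h4
    simp at h5
    linarith
  refine hg.eq_of_forall hy fun w => ?_
  have h1 := key v w
  have h2 := key w v
  rw [hsymm.eq v w] at h1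
  have h3 := hL v w
  rw [hg.symm _ hy v (fderiv ℝ γ y w)] at h3
  simp only [map_add, map_smul, add_apply, smul_apply, smul_eq_mul, hg.metric_christoffel hy,
    christoffelFirst, sub_apply, ContinuousLinearMap.flip_apply]
  rw [hg.fderiv_metric_symm hy w v]
  linarith

end CoordGeom

open CoordGeom

/-- A block whose metric is nondegenerate, whose radius function `ρ` satisfies
`|dρ|² = h(ρ)` and `Hess ρ = h'(ρ) / 2 * g`, and has at most one critical point. -/
def PlanarBlock.IsAdmissible (h : ℝ → ℝ) (b : PlanarBlock) : Prop :=
  ∃ γ : ℝ × ℝ → ℝ × ℝ,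
    IsWarpingData b.form b.radius γ (fun y => deriv h (b.radius y) / 2) b.domain ∧
    (∀ y ∈ b.domain, fderiv ℝ b.radius y (γ y) = h (b.radius y)) ∧
    ∀ y ∈ b.domain, ∀ y' ∈ b.domain, fderiv ℝ b.radius y = 0 → fderiv ℝ b.radius y' = 0 → y = y'

theorem staticBlock_form_apply (h : ℝ → ℝ) (rH : ℝ) (x v w : ℝ × ℝ) :
    (staticBlock h rH).form x v w = -(h x.2) * (v.1 * w.1) + (h x.2)⁻¹ * (v.2 * w.2) := by
  simp [staticBlock]

theorem staticBlock_isAdmissible {h : ℝ → ℝ} {rH : ℝ} (hh : IsMetricCoefficient h rH) :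
    (staticBlock h rH).IsAdmissible h := by
  have hcd : ∀ x ∈ (staticBlock h rH).domain, ContDiffAt ℝ ∞ h x.2 := fun x hx =>
    hh.smooth.contDiffAt (Ioi_mem_nhds (hh.nonneg.trans_lt hx))
  have hpos : ∀ x ∈ (staticBlock h rH).domain, 0 < h x.2 := fun x hx => hh.pos _ hx
  have hmetric : IsMetricOn (staticBlock h rH).form (staticBlock h rH).domain :=
    { isOpen := isOpen_lt continuous_const continuous_snd
      smooth := by
        intro x hx
        have h1 : ContDiffAt ℝ ∞ (fun x : ℝ × ℝ => h x.2) x := (hcd x hx).comp x contDiffAt_snd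
        exact (h1.neg.smul contDiffAt_const).add
          ((h1.inv (hpos x hx).ne').smul contDiffAt_const)
      symm := by
        intro x _ v w
        rw [staticBlock_form_apply, staticBlock_form_apply]; ring
      invertible := by
        intro x hx
        refine isInvertible_of_nondegenerate fun v hv => ?_
        have h1 := hv (1, 0)
        have h2 := hv (0, 1)
        rw [staticBlock_form_apply] at h1 h2
        have h3 := (hpos x hx).ne'
        ext
        · simpa [h3] using h1
        · simpa [h3] using h2 }
  have hfd : ∀ x : ℝ × ℝ, fderiv ℝ (staticBlock h rH).radius x = ContinuousLinearMap.snd ℝ ℝ ℝ :=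
    fun x => (hasFDerivAt_snd (𝕜 := ℝ) (E := ℝ) (F := ℝ) (p := x)).fderiv
  have hsm : ∀ x ∈ (staticBlock h rH).domain,
      ContDiffAt ℝ ∞ (fun x : ℝ × ℝ => ((0 : ℝ), h x.2)) x := fun x hx =>
    contDiffAt_const.prodMk ((hcd x hx).comp x contDiffAt_snd)
  have hgrad : ∀ x ∈ (staticBlock h rH).domain, ∀ w,
      (staticBlock h rH).form x (0, h x.2) w = fderiv ℝ (staticBlock h rH).radius x w := by
    intro x hx w
    have h3 := (hpos x hx).ne'
    rw [staticBlock_form_apply, hfd]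
    simp [h3]
  -- The gradient of `r` is `h ∂_r`; the radius has no critical point because `dr(∂_r) = 1`.
  refine ⟨fun x => (0, h x.2), ⟨hmetric, fun x _ => contDiffAt_snd,
    fun x hx => hh.nonneg.trans_lt hx, hsm, hgrad, fun x hx v => ?_⟩, fun x _ => by rw [hfd]; rfl,
    fun x _ _ _ h0 => ?_⟩
  · have h3 := (hpos x hx).ne'
    have hd := ((hcd x hx).differentiableAt (by simp)).hasDerivAt
    have hd2 : HasFDerivAt (fun x : ℝ × ℝ => h x.2) _ x :=
      hd.hasFDerivAt.comp x (hasFDerivAt_snd (𝕜 := ℝ) (E := ℝ) (F := ℝ) (p := x))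
    have hγ := (hasFDerivAt_const (0 : ℝ) x).prodMk hd2
    refine covDeriv_grad_of_lieDeriv hmetric hx contDiffAt_snd
      ((hsm x hx).differentiableAt (by simp)) hgrad (fun v w => ?_) v
    rw [hγ.fderiv, ← fderiv_apply_apply (hmetric.differentiableAt hx)]
    simp only [staticBlock_form_apply]
    have hi : HasFDerivAt (fun x : ℝ × ℝ => (h x.2)⁻¹) _ x :=
      (hasDerivAt_inv h3).comp_hasFDerivAt x hd2
    have h4 := (hd2.neg.mul_const (v.1 * w.1)).add (hi.mul_const (v.2 * w.2))
    rw [show fderiv ℝ (fun y' : ℝ × ℝ => -(h y'.2) * (v.1 * w.1) + (h y'.2)⁻¹ * (v.2 * w.2)) x = _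
      from h4.fderiv]
    simp [staticBlock]
    field_simp
    ring
  · rw [hfd] at h0
    simpa using congrArg (fun L : ℝ × ℝ →L[ℝ] ℝ => L (0, 1)) h0

/-! ### Kruskal–Szekeres blocks are admissible -/

section Kruskal

variable {h : ℝ → ℝ} {z : ℝ} {Φ : ℝ → ℝ}

/-- Each of the finitely many other positive zeros cuts off a closed ray on its side of `z`. -/
theorem isOpen_horizonInterval (hfin : {r : ℝ | 0 < r ∧ h r = 0}.Finite) (hz : 0 < z) :
    IsOpen (horizonInterval h z) := by
  have hEq : horizonInterval h z
      = Set.Ioi 0 ∩ ⋂ s ∈ {r : ℝ | 0 < r ∧ h r = 0} \ {z}, {r | s ∉ Set.uIcc z r} := by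
    ext r
    simp only [horizonInterval, Set.mem_ofPred_eq, Set.mem_inter_iff, Set.mem_Ioi, Set.mem_iInter,
      Set.mem_sdiff, Set.mem_singleton_iff]
    refine and_congr_right fun hr => ⟨fun H s hs hsr => hs.2 (H s hsr hs.1.2), fun H s hs hs0 => ?_⟩
    by_contra hsz
    refine H s ⟨⟨?_, hs0⟩, hsz⟩ hs
    -- Zeros of `h` at nonpositive arguments do not interfere: the segment between `z` and `r`
    -- consists of positive numbers.
    exact (lt_min hz hr).trans_le (Set.mem_uIcc.1 hs |>.elim (fun h => (min_le_left _ _).trans h.1)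
      fun h => (min_le_right _ _).trans h.1)
  rw [hEq]
  refine isOpen_Ioi.inter ((hfin.subset Set.sdiff_subset).isOpen_biInter fun s hs => ?_)
  rcases lt_or_gt_of_ne hs.2 with hsz | hsz
  · convert isOpen_lt (continuous_const : Continuous fun _ : ℝ => s) continuous_id using 1
    ext r
    simp only [Set.mem_ofPred_eq, id, Set.mem_uIcc, not_or, not_and, not_le]
    exact ⟨fun H => by_contra fun hc => absurd (H.2 (not_lt.1 hc)) (not_lt.2 hsz.le),
      fun H => ⟨fun h1 => absurd h1 (not_le.2 hsz), fun h1 => absurd h1 (not_le.2 H)⟩⟩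
  · convert isOpen_lt continuous_id (continuous_const : Continuous fun _ : ℝ => s) using 1
    ext r
    simp only [Set.mem_ofPred_eq, id, Set.mem_uIcc, not_or, not_and, not_le]
    exact ⟨fun H => H.1 hsz.le, fun H => ⟨fun _ => H, fun _ => hsz⟩⟩

end Kruskal

namespace IsKruskalPotential

variable {h : ℝ → ℝ} {z : ℝ} {Φ : ℝ → ℝ}

theorem contDiffAt (hΦ : IsKruskalPotential h z Φ) (hJ : IsOpen (horizonInterval h z)) {r : ℝ}
    (hr : r ∈ horizonInterval h z) : ContDiffAt ℝ ∞ Φ r :=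
  hΦ.smooth.contDiffAt (hJ.mem_nhds hr)

theorem hasStrictDerivAt (hΦ : IsKruskalPotential h z Φ) (hJ : IsOpen (horizonInterval h z))
    {r : ℝ} (hr : r ∈ horizonInterval h z) : HasStrictDerivAt Φ (deriv Φ r) r :=
  (hΦ.contDiffAt hJ hr).hasStrictDerivAt (by simp)

theorem isOpen_image (hΦ : IsKruskalPotential h z Φ) (hJ : IsOpen (horizonInterval h z)) :
    IsOpen (Φ '' horizonInterval h z) := by
  rw [isOpen_iff_mem_nhds]
  rintro _ ⟨r, hr, rfl⟩
  rw [← (hΦ.hasStrictDerivAt hJ hr).map_nhds_eq (hΦ.ode r hr).1]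
  exact Filter.image_mem_map (hJ.mem_nhds hr)

theorem invFunOn_apply (hΦ : IsKruskalPotential h z Φ) {r : ℝ} (hr : r ∈ horizonInterval h z) :
    Function.invFunOn Φ (horizonInterval h z) (Φ r) = r :=
  hΦ.strictMono.injOn.leftInvOn_invFunOn hr

theorem invFunOn_mem {s : ℝ} (hs : s ∈ Φ '' horizonInterval h z) :
    Function.invFunOn Φ (horizonInterval h z) s ∈ horizonInterval h z :=
  Function.invFunOn_mem hs

theorem apply_invFunOn {s : ℝ} (hs : s ∈ Φ '' horizonInterval h z) :
    Φ (Function.invFunOn Φ (horizonInterval h z) s) = s :=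
  Function.invFunOn_eq hs

theorem hasDerivAt_invFunOn (hΦ : IsKruskalPotential h z Φ) (hJ : IsOpen (horizonInterval h z))
    {s : ℝ} (hs : s ∈ Φ '' horizonInterval h z) :
    HasDerivAt (Function.invFunOn Φ (horizonInterval h z))
      (deriv Φ (Function.invFunOn Φ (horizonInterval h z) s))⁻¹ s := by
  obtain ⟨r, hr, rfl⟩ := hs
  rw [hΦ.invFunOn_apply hr]
  refine ((hΦ.hasStrictDerivAt hJ hr).to_local_left_inverse (hΦ.ode r hr).1 ?_).hasDerivAt
  filter_upwards [hJ.mem_nhds hr] with r' hr' using hΦ.invFunOn_apply hr'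

/-- The inverse function theorem gives a smooth local inverse, and the global one agrees with it
nearby by local uniqueness. -/
theorem contDiffAt_invFunOn (hΦ : IsKruskalPotential h z Φ) (hJ : IsOpen (horizonInterval h z))
    {s : ℝ} (hs : s ∈ Φ '' horizonInterval h z) :
    ContDiffAt ℝ ∞ (Function.invFunOn Φ (horizonInterval h z)) s := by
  obtain ⟨r, hr, rfl⟩ := hs
  have hc := hΦ.contDiffAt hJ hr
  have hd := ((hΦ.hasStrictDerivAt hJ hr).hasDerivAt).hasFDerivAt_equiv (hΦ.ode r hr).1
  have h1 := hc.to_localInverse hd (by simp)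
  refine h1.congr_of_eventuallyEq ?_
  refine HasStrictFDerivAt.localInverse_unique (hc.hasStrictFDerivAt' hd (by simp)) ?_
  filter_upwards [hJ.mem_nhds hr] with r' hr' using hΦ.invFunOn_apply hr'

/-- The differentiated defining equation of the potential. -/
theorem mul_deriv_deriv (hΦ : IsKruskalPotential h z Φ) (hJ : IsOpen (horizonInterval h z))
    (hh : ContDiffOn ℝ ∞ h (Set.Ioi 0)) {r : ℝ} (hr : r ∈ horizonInterval h z) :
    deriv Φ r = 1 / deriv h z * (deriv h r * deriv Φ r + h r * deriv (deriv Φ) r) := by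
  have hc := hΦ.contDiffAt hJ hr
  have hd2 : DifferentiableAt ℝ (deriv Φ) r := by
    have := (hc.fderiv_right (m := 1) (by norm_cast)).differentiableAt (by simp)
    exact this.clm_apply (differentiableAt_const (1 : ℝ))
  have hdh : DifferentiableAt ℝ h r :=
    (hh.contDiffAt (Ioi_mem_nhds hr.1)).differentiableAt (by simp)
  have hev : Φ =ᶠ[𝓝 r] fun r => 1 / deriv h z * (h r * deriv Φ r) := by
    filter_upwards [hJ.mem_nhds hr] with r' hr'
    obtain ⟨h1, h2⟩ := hΦ.ode r' hr'
    rw [div_eq_iff h1] at h2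
    rw [h2]; ring
  have h1 := ((hdh.hasDerivAt.mul hd2.hasDerivAt).const_mul (1 / deriv h z)).deriv
  exact hev.deriv_eq.trans h1

end IsKruskalPotential

section Kruskal

variable {h : ℝ → ℝ} {z : ℝ} {Φ : ℝ → ℝ}

theorem kruskalBlock_form_apply (h : ℝ → ℝ) (z : ℝ) (Φ : ℝ → ℝ) (x v w : ℝ × ℝ) :
    (kruskalBlock h z Φ).form x v w =
      2 * (1 / deriv h z) / deriv Φ (kruskalRadius h z Φ x) * (v.1 * w.2 + v.2 * w.1) := by
  simp [kruskalBlock]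
  ring

/-- The gradient of `ρ` is `h'(z)/2` times the Euler field `u ∂_u + v ∂_v`, hence smooth across the
horizon. The defining equation of `Φ` gives `dρ(γ) = h(ρ)`, its derivative gives the Hessian, and
`dρ` can vanish only at `u = v = 0`. -/
theorem kruskalBlock_isAdmissible (hh : ContDiffOn ℝ ∞ h (Set.Ioi 0)) (hS : HasSimpleHorizons h)
    (hz : 0 < z) (hz0 : h z = 0) (hΦ : IsKruskalPotential h z Φ) :
    (kruskalBlock h z Φ).IsAdmissible h := by
  have hJ := isOpen_horizonInterval hS.1 hz
  have hz' : deriv h z ≠ 0 := hS.2 z hz hz0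
  have hmem : ∀ x ∈ (kruskalBlock h z Φ).domain, kruskalRadius h z Φ x ∈ horizonInterval h z :=
    fun x hx => IsKruskalPotential.invFunOn_mem hx
  have hΦ0 : ∀ x ∈ (kruskalBlock h z Φ).domain, deriv Φ (kruskalRadius h z Φ x) ≠ 0 :=
    fun x hx => (hΦ.ode _ (hmem x hx)).1
  have hρsm : ∀ x ∈ (kruskalBlock h z Φ).domain, ContDiffAt ℝ ∞ (kruskalRadius h z Φ) x :=
    fun x hx => (hΦ.contDiffAt_invFunOn hJ hx).comp x (contDiffAt_fst.mul contDiffAt_snd)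
  have hρd : ∀ x ∈ (kruskalBlock h z Φ).domain, HasFDerivAt (kruskalRadius h z Φ)
      ((deriv Φ (kruskalRadius h z Φ x))⁻¹ •
        (x.1 • ContinuousLinearMap.snd ℝ ℝ ℝ + x.2 • ContinuousLinearMap.fst ℝ ℝ ℝ)) x := by
    intro x hx
    have h1 : HasFDerivAt (fun x : ℝ × ℝ => x.1 * x.2) _ x :=
      (hasFDerivAt_fst (𝕜 := ℝ) (E := ℝ) (F := ℝ) (p := x)).mul
        (hasFDerivAt_snd (𝕜 := ℝ) (E := ℝ) (F := ℝ) (p := x))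
    exact (hΦ.hasDerivAt_invFunOn hJ hx).comp_hasFDerivAt x h1
  have hρd' : ∀ x ∈ (kruskalBlock h z Φ).domain, ∀ v, fderiv ℝ (kruskalRadius h z Φ) x v
      = (deriv Φ (kruskalRadius h z Φ x))⁻¹ * (x.1 * v.2 + x.2 * v.1) := by
    intro x hx v
    rw [(hρd x hx).fderiv]
    simp
    ring
  have hΦ'sm : ∀ x ∈ (kruskalBlock h z Φ).domain,
      ContDiffAt ℝ ∞ (deriv Φ) (kruskalRadius h z Φ x) := by
    intro x hx
    have := (hΦ.contDiffAt hJ (hmem x hx)).fderiv_right (m := ∞) (by norm_cast)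
    exact this.clm_apply (contDiffAt_const (c := (1 : ℝ)))
  have hmetric : IsMetricOn (kruskalBlock h z Φ).form (kruskalBlock h z Φ).domain :=
    { isOpen := (hΦ.isOpen_image hJ).preimage (continuous_fst.mul continuous_snd)
      smooth := by
        intro x hx
        exact ((contDiffAt_const (c := 2 * (1 / deriv h z))).div
          ((hΦ'sm x hx).comp x (hρsm x hx)) (hΦ0 x hx)).smul contDiffAt_const
      symm := by
        intro x _ v w
        rw [kruskalBlock_form_apply, kruskalBlock_form_apply]; ring
      invertible := by
        intro x hx
        refine isInvertible_of_nondegenerate fun v hv => ?_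
        have h1 := hv (1, 0)
        have h2 := hv (0, 1)
        rw [kruskalBlock_form_apply] at h1 h2
        have h3 := hΦ0 x hx
        ext
        · simpa [h3, hz'] using h2
        · simpa [h3, hz'] using h1 }
  have hsm : ∀ x : ℝ × ℝ, ContDiffAt ℝ ∞ (fun x : ℝ × ℝ => (deriv h z / 2) • x) x :=
    fun x => contDiffAt_id.const_smul _
  have hgrad : ∀ x ∈ (kruskalBlock h z Φ).domain, ∀ w,
      (kruskalBlock h z Φ).form x ((deriv h z / 2) • x) w
        = fderiv ℝ (kruskalRadius h z Φ) x w := by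
    intro x hx w
    have h3 := hΦ0 x hx
    rw [kruskalBlock_form_apply, hρd' x hx]
    simp only [Prod.smul_fst, Prod.smul_snd, smul_eq_mul]
    field_simp
  have hnorm : ∀ x ∈ (kruskalBlock h z Φ).domain,
      fderiv ℝ (kruskalRadius h z Φ) x ((deriv h z / 2) • x) = h (kruskalRadius h z Φ x) := by
    intro x hx
    have h3 := hΦ0 x hx
    have h4 := (hΦ.ode _ (hmem x hx)).2
    have h5 : Φ (kruskalRadius h z Φ x) = x.1 * x.2 := IsKruskalPotential.apply_invFunOn hx
    rw [hρd' x hx]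
    rw [h5] at h4
    simp only [Prod.smul_fst, Prod.smul_snd, smul_eq_mul]
    field_simp at h4 ⊢
    linarith
  refine ⟨fun x => (deriv h z / 2) • x, ⟨hmetric, hρsm, fun x hx => (hmem x hx).1,
    fun x _ => hsm x, hgrad, fun x hx v => ?_⟩, hnorm, fun x hx y hy hx0 hy0 => ?_⟩
  · have h3 := hΦ0 x hx
    refine covDeriv_grad_of_lieDeriv hmetric hx (hρsm x hx)
      ((hsm x).differentiableAt (by simp)) hgrad (fun v w => ?_) v
    have hγ : HasFDerivAt (fun x : ℝ × ℝ => (deriv h z / 2) • x) _ x :=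
      (hasFDerivAt_id (𝕜 := ℝ) x).const_smul (deriv h z / 2)
    rw [hγ.fderiv, ← fderiv_apply_apply (hmetric.differentiableAt hx)]
    simp only [kruskalBlock_form_apply]
    have h4 : HasFDerivAt (fun x => deriv Φ (kruskalRadius h z Φ x)) _ x :=
      ((hΦ'sm x hx).differentiableAt (by simp)).hasDerivAt.comp_hasFDerivAt x
        ((hρsm x hx).differentiableAt (by simp)).hasFDerivAt
    have h5 := (((hasDerivAt_inv h3).comp_hasFDerivAt x h4).const_mul
      (2 * (1 / deriv h z))).mul_const (v.1 * w.2 + v.2 * w.1)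
    have h6 : fderiv ℝ (fun y' => 2 * (1 / deriv h z) / deriv Φ (kruskalRadius h z Φ y')
      * (v.1 * w.2 + v.2 * w.1)) x = _ := h5.fderiv
    have h7 := hΦ.mul_deriv_deriv hJ hh (hmem x hx)
    rw [h6]
    have h8 := hnorm x hx
    simp only [smul_apply, smul_eq_mul, ContinuousLinearMap.id_apply, h8, Prod.smul_fst,
      Prod.smul_snd]
    -- `mul_deriv_deriv` solved for `h'(ρ)`: the constant `h'(z)` comes from the linear field, the
    -- correction from differentiating `1 / Φ'(ρ)`.
    have h9 : deriv h ((kruskalBlock h z Φ).radius x) = deriv h z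
        - h (kruskalRadius h z Φ x) * deriv (deriv Φ) (kruskalRadius h z Φ x)
          / deriv Φ (kruskalRadius h z Φ x) := by
      change deriv h (kruskalRadius h z Φ x) = _
      field_simp at h7 ⊢
      linarith
    rw [h9]
    field_simp
    ring
  · have e1 : x.1 = 0 ∧ x.2 = 0 := by
      have h1 := hρd' x hx (0, 1)
      have h2 := hρd' x hx (1, 0)
      have h3 := hΦ0 x hx
      rw [show fderiv ℝ (kruskalRadius h z Φ) x = 0 from hx0] at h1 h2
      simp [h3] at h1 h2
      exact ⟨h1, h2⟩
    have e2 : y.1 = 0 ∧ y.2 = 0 := by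
      have h1 := hρd' y hy (0, 1)
      have h2 := hρd' y hy (1, 0)
      have h3 := hΦ0 y hy
      rw [show fderiv ℝ (kruskalRadius h z Φ) y = 0 from hy0] at h1 h2
      simp [h3] at h1 h2
      exact ⟨h1, h2⟩
    exact Prod.ext (e1.1.trans e2.1.symm) (e1.2.trans e2.2.symm)

end Kruskal

/-! ### The fibre metric in charts -/

namespace FibreMetric

variable {m : ℕ} {N : Type*} [TopologicalSpace N] [ChartedSpace (EuclideanSpace ℝ (Fin m)) N]
  [IsManifold (𝓡 m) ∞ N]

/-- The frame of the trivialization is the coordinate frame by `mfderiv_extChartAt_symm_eq`, so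
these functions are the metric coefficients in the chart. -/
theorem contMDiffOn_inner_symmL (gN : FibreMetric m N) (c : N) (v w : EuclideanSpace ℝ (Fin m)) :
    ContMDiffOn (𝓡 m) 𝓘(ℝ) ∞
      (fun q => gN.inner q
        ((trivializationAt (EuclideanSpace ℝ (Fin m)) (TangentSpace (𝓡 m)) c).symmL ℝ q v)
        ((trivializationAt (EuclideanSpace ℝ (Fin m)) (TangentSpace (𝓡 m)) c).symmL ℝ q w))
      (chartAt (EuclideanSpace ℝ (Fin m)) c).source := by
  intro q hq
  set e := trivializationAt (EuclideanSpace ℝ (Fin m)) (TangentSpace (𝓡 m) : N → Type) c with he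
  have hs : ∀ v : EuclideanSpace ℝ (Fin m), ContMDiffWithinAt (𝓡 m)
      ((𝓡 m).prod 𝓘(ℝ, EuclideanSpace ℝ (Fin m))) ∞
      (fun q => (⟨q, e.symmL ℝ q v⟩ :
        Bundle.TotalSpace (EuclideanSpace ℝ (Fin m)) (TangentSpace (𝓡 m) : N → Type)))
      (chartAt (EuclideanSpace ℝ (Fin m)) c).source q := by
    intro v
    refine (e.contMDiffWithinAt_section _ (s := fun q => e.symmL ℝ q v) hq).2 ?_
    refine (contMDiffWithinAt_const (c := v)).congr (fun q' hq' => ?_) ?_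
    · rw [e.symmL_apply]
      · exact congrArg Prod.snd (e.apply_mk_symm hq' v)
      · exact hq'
    · rw [e.symmL_apply]
      · exact congrArg Prod.snd (e.apply_mk_symm hq v)
      · exact hq
  have : ContMDiffWithinAt (𝓡 m) ((𝓡 m).prod 𝓘(ℝ)) ∞
      (fun q ↦ Bundle.TotalSpace.mk' ℝ (E := Bundle.Trivial N ℝ) q
        (gN.inner q (e.symmL ℝ q v) (e.symmL ℝ q w)))
      (chartAt (EuclideanSpace ℝ (Fin m)) c).source q := by
    apply ContMDiffWithinAt.clm_bundle_apply₂ (F₁ := EuclideanSpace ℝ (Fin m))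
      (F₂ := EuclideanSpace ℝ (Fin m))
    · exact gN.contMDiff.contMDiffAt.contMDiffWithinAt
    · exact hs v
    · exact hs w
  simp only [Bundle.contMDiffWithinAt_totalSpace] at this
  exact this.2

theorem coord_apply (gN : FibreMetric m N) (c : N) (y v w : EuclideanSpace ℝ (Fin m)) :
    gN.coord c y v w = gN.inner ((extChartAt (𝓡 m) c).symm y)
      (mfderiv 𝓘(ℝ, EuclideanSpace ℝ (Fin m)) (𝓡 m) (extChartAt (𝓡 m) c).symm y v)
      (mfderiv 𝓘(ℝ, EuclideanSpace ℝ (Fin m)) (𝓡 m) (extChartAt (𝓡 m) c).symm y w) := rfl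

theorem mfderiv_extChartAt_symm_eq (c : N) {q : N}
    (hq : q ∈ (chartAt (EuclideanSpace ℝ (Fin m)) c).source) :
    mfderiv 𝓘(ℝ, EuclideanSpace ℝ (Fin m)) (𝓡 m) (extChartAt (𝓡 m) c).symm
      (extChartAt (𝓡 m) c q)
      = (trivializationAt (EuclideanSpace ℝ (Fin m)) (TangentSpace (𝓡 m)) c).symmL ℝ q := by
  rw [TangentBundle.symmL_trivializationAt hq, ModelWithCorners.range_eq_univ,
    mfderivWithin_univ]

theorem contDiffAt_coord (gN : FibreMetric m N) (c : N) {y : EuclideanSpace ℝ (Fin m)}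
    (hy : y ∈ (extChartAt (𝓡 m) c).target) : ContDiffAt ℝ ∞ (gN.coord c) y := by
  have hO := isOpen_extChartAt_target (I := 𝓡 m) c
  suffices h : ContDiffOn ℝ ∞ (gN.coord c) (extChartAt (𝓡 m) c).target from
    h.contDiffAt (hO.mem_nhds hy)
  refine contDiffOn_clm_apply.2 fun v => contDiffOn_clm_apply.2 fun w => ?_
  rw [← contMDiffOn_iff_contDiffOn]
  have hmaps : Set.MapsTo (extChartAt (𝓡 m) c).symm (extChartAt (𝓡 m) c).target
      (chartAt (EuclideanSpace ℝ (Fin m)) c).source := by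
    intro y hy
    rw [← extChartAt_source (𝓡 m)]
    exact (extChartAt (𝓡 m) c).map_target hy
  refine ((gN.contMDiffOn_inner_symmL c v w).comp (contMDiffOn_extChartAt_symm c) hmaps).congr
    fun y' hy' => ?_
  have h1 := mfderiv_extChartAt_symm_eq c (hmaps hy')
  rw [(extChartAt (𝓡 m) c).right_inv hy'] at h1
  rw [coord_apply, h1]
  rfl

theorem isInvertible_mfderiv_extChartAt_symm (c : N) {y : EuclideanSpace ℝ (Fin m)}
    (hy : y ∈ (extChartAt (𝓡 m) c).target) :
    (mfderiv 𝓘(ℝ, EuclideanSpace ℝ (Fin m)) (𝓡 m) (extChartAt (𝓡 m) c).symm y).IsInvertible := by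
  have h := isInvertible_mfderivWithin_extChartAt_symm (I := 𝓡 m) hy
  rwa [ModelWithCorners.range_eq_univ, mfderivWithin_univ] at h

theorem coord_pos (gN : FibreMetric m N) (c : N) {y : EuclideanSpace ℝ (Fin m)}
    (hy : y ∈ (extChartAt (𝓡 m) c).target) {X : EuclideanSpace ℝ (Fin m)} (hX : X ≠ 0) :
    0 < gN.coord c y X X := by
  rw [coord_apply]
  refine gN.pos _ _ fun h0 => hX ?_
  exact (isInvertible_mfderiv_extChartAt_symm c hy).injective (h0.trans (map_zero _).symm)

theorem isMetricOn_coord (gN : FibreMetric m N) (c : N) :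
    IsMetricOn (gN.coord c) (extChartAt (𝓡 m) c).target where
  isOpen := isOpen_extChartAt_target c
  smooth _ hy := gN.contDiffAt_coord c hy
  symm y _ v w := by rw [coord_apply, coord_apply, gN.symm]
  invertible y hy := isInvertible_of_nondegenerate fun v hv => by
    by_contra h0
    exact (gN.coord_pos c hy h0).ne' (hv v)

/-- A unit vector of the chart expression of the metric comes from a unit tangent vector with the
same Ricci curvature. -/
theorem exists_ric_eq (gN : FibreMetric m N) (x : N) {X : EuclideanSpace ℝ (Fin m)}
    (hX : gN.coord x (extChartAt (𝓡 m) x x) X X = 1) :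
    ∃ Y : TangentSpace (𝓡 m) x, gN.inner x Y Y = 1 ∧
      gN.ric x Y = ricci (gN.coord x) (extChartAt (𝓡 m) x x) X X := by
  refine ⟨X, ?_, ?_⟩
  · have h1 := mfderiv_extChartAt_symm_eq x (mem_chart_source (EuclideanSpace ℝ (Fin m)) x)
    have h2 : mfderiv 𝓘(ℝ, EuclideanSpace ℝ (Fin m)) (𝓡 m) (extChartAt (𝓡 m) x).symm
      (extChartAt (𝓡 m) x x) = ContinuousLinearMap.id ℝ _ := by
      rw [← mfderivWithin_range_extChartAt_symm (I := 𝓡 m) (x := x),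
        ModelWithCorners.range_eq_univ, mfderivWithin_univ]
    rw [coord_apply, h2] at hX
    -- The base point in `hX` equals `x` only propositionally, while the type of tangent vectors
    -- depends on it; hence the detour through a variable `q`.
    have h3 : ∀ q : N, q = x →
        gN.inner q (X : EuclideanSpace ℝ (Fin m)) (X : EuclideanSpace ℝ (Fin m)) = 1 →
        gN.inner x (X : EuclideanSpace ℝ (Fin m)) (X : EuclideanSpace ℝ (Fin m)) = 1 := by
      rintro _ rfl h
      exact h
    exact h3 _ (extChartAt_to_inv x) hX
  · unfold ric
    rw [mfderiv_extChartAt_self]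
    rfl

end FibreMetric

/-! ### Umbilic hypersurfaces in warped products -/

namespace CoordGeom

section General

variable {V W : Type*} [NormedAddCommGroup V] [NormedSpace ℝ V]
  [NormedAddCommGroup W] [NormedSpace ℝ W]
  {G : W → W →L[ℝ] W →L[ℝ] ℝ} {D : Set W} {F ν : V → W} {lam : ℝ} {x : V}

/-- `F` is an immersion at `x`, with values in `D` and a unit normal `ν` such that `∇ν = λ dF`. -/
structure IsUmbilicPoint (G : W → W →L[ℝ] W →L[ℝ] ℝ) (D : Set W) (F ν : V → W) (lam : ℝ) (x : V) :
    Prop where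
  mem : F x ∈ D
  smooth : ContDiffAt ℝ ∞ F x
  injective : Function.Injective (fderiv ℝ F x)
  normal : IsUnitNormalNear G F x ν
  covDeriv_eq : ∀ a, covDeriv G F ν x a = lam • fderiv ℝ F x a

theorem IsTimelikeUmbilicNear.exists_isUmbilicPoint [FiniteDimensional ℝ V]
    [FiniteDimensional ℝ W] (hG : IsMetricOn G D)
    (hdim : Module.finrank ℝ W = Module.finrank ℝ V + 1)
    (hF : ∀ᶠ x' in 𝓝 x, F x' ∈ D ∧ ContDiffAt ℝ ∞ F x') (h : IsTimelikeUmbilicNear G F x lam) :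
    ∃ ν, ∀ᶠ x' in 𝓝 x, IsUmbilicPoint G D F ν lam x' := by
  obtain ⟨h1, ν, h2, h3⟩ := h
  refine ⟨ν, ?_⟩
  filter_upwards [hF, h1, h3, eventually_eventually_nhds.2 h2] with x' k1 k2 k3 k4
  exact ⟨k1.1, k1.2, k2.1, k4, hG.covDeriv_eq_of_umbilic hdim k1.1
    (k1.2.of_le (by norm_cast)) k2.1 k4 k3⟩

namespace IsUmbilicPoint

theorem normal_apply (h : IsUmbilicPoint G D F ν lam x) (a : V) :
    G (F x) (ν x) (fderiv ℝ F x a) = 0 := h.normal.self_of_nhds.2.1 a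

theorem normal_self (h : IsUmbilicPoint G D F ν lam x) : G (F x) (ν x) (ν x) = 1 :=
  h.normal.self_of_nhds.2.2

theorem normal_ne_zero (h : IsUmbilicPoint G D F ν lam x) : ν x ≠ 0 := by
  intro h0
  have := h.normal_self
  simp [h0] at this

theorem contDiffAt_normal (h : IsUmbilicPoint G D F ν lam x) : ContDiffAt ℝ ∞ ν x :=
  h.normal.self_of_nhds.1

theorem exists_fderiv_eq [FiniteDimensional ℝ V] [FiniteDimensional ℝ W] (hG : IsMetricOn G D)
    (hdim : Module.finrank ℝ W = Module.finrank ℝ V + 1) (h : IsUmbilicPoint G D F ν lam x) {w : W}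
    (hw : G (F x) (ν x) w = 0) : ∃ a, fderiv ℝ F x a = w :=
  hG.exists_of_normal hdim h.mem h.injective h.normal_ne_zero h.normal_apply hw

/-- The curvature annihilates the normal of a totally umbilic hypersurface with constant
factor. -/
theorem riemann_normal [FiniteDimensional ℝ V] [FiniteDimensional ℝ W] (hG : IsMetricOn G D)
    (hdim : Module.finrank ℝ W = Module.finrank ℝ V + 1)
    (h : ∀ᶠ x' in 𝓝 x, IsUmbilicPoint G D F ν lam x') {X Y : W} (hX : G (F x) (ν x) X = 0)
    (hY : G (F x) (ν x) Y = 0) : riemann G (F x) X Y (ν x) = 0 := by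
  have h0 := h.self_of_nhds
  obtain ⟨a, rfl⟩ := h0.exists_fderiv_eq hG hdim hX
  obtain ⟨b, rfl⟩ := h0.exists_fderiv_eq hG hdim hY
  rw [hG.riemann_of_covDeriv_eq (f := fun _ => lam) h0.mem (h0.smooth.of_le (by norm_cast))
    (h0.contDiffAt_normal.of_le (by norm_cast)) (differentiableAt_const _)
    (h.mono fun x' hx' => hx'.covDeriv_eq)]
  simp

/-- If `λ = 0`, the hypersurface is totally geodesic and every unit normal is parallel. -/
theorem totallyGeodesic [FiniteDimensional ℝ V] [FiniteDimensional ℝ W] (hG : IsMetricOn G D)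
    (hdim : Module.finrank ℝ W = Module.finrank ℝ V + 1) (h : IsUmbilicPoint G D F ν 0 x)
    {ν' : V → W} (hν' : IsUnitNormalNear G F x ν') :
    (∀ a b, secondFF G F ν' x a b = 0) ∧ ∀ a, covDeriv G F ν' x a = 0 := by
  have hF : ContDiffAt ℝ 2 F x := h.smooth.of_le (by norm_cast)
  have h0 := hν'.self_of_nhds
  have h1 : ∀ a b, secondFF G F ν' x a b = 0 := by
    intro a b
    have h2 := hG.metric_covDeriv_tangent h.mem hF h.normal a b
    rw [h.covDeriv_eq, zero_smul, map_zero, zero_apply] at h2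
    -- The covariant second derivative of `F` is orthogonal to `ν`, hence tangent, hence orthogonal
    -- to `ν'` too. This avoids showing `ν' = ± ν`.
    obtain ⟨c, hc⟩ := h.exists_fderiv_eq hG hdim
      (w := fderiv ℝ (fun x' => fderiv ℝ F x' b) x a
        + christoffel G (F x) (fderiv ℝ F x a) (fderiv ℝ F x b)) (by
          rw [hG.symm _ h.mem]
          rw [secondFF] at h2
          linarith)
    rw [secondFF, ← hc, hG.symm _ h.mem, h0.2.1 c, neg_zero]
  refine ⟨h1, fun a => ?_⟩
  refine hG.eq_of_tangent_of_normal hdim h.mem h.injective h0.2.2 h0.2.1 (fun b => ?_) ?_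
  · rw [hG.metric_covDeriv_tangent h.mem hF hν', h1]; simp
  · rw [hG.metric_covDeriv_self h.mem (hF.differentiableAt (by simp)) hν']; simp

end IsUmbilicPoint

end General

section Warped

variable {V B E : Type*} [NormedAddCommGroup V] [NormedSpace ℝ V]
  [NormedAddCommGroup B] [NormedSpace ℝ B] [NormedAddCommGroup E] [NormedSpace ℝ E]
  {gB : B → B →L[ℝ] B →L[ℝ] ℝ} {ρ : B → ℝ} {γ : B → B} {κ : B → ℝ} {U : Set B}
  {gE : E → E →L[ℝ] E →L[ℝ] ℝ} {O : Set E} {F ν : V → B × E} {lam : ℝ} {x : V}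

theorem IsUmbilicPoint.snd_not_surjective (hw : IsWarpingData gB ρ γ κ U) (hE : IsMetricOn gE O)
    (h : IsUmbilicPoint (warped gB ρ gE) (U ×ˢ O) F ν lam x) (h1 : (ν x).1 = 0) :
    ¬ Function.Surjective fun a => (fderiv ℝ F x a).2 := by
  intro hs
  refine h.normal_ne_zero (Prod.ext h1 (hE.eq_of_forall h.mem.2 fun X => ?_))
  obtain ⟨a, ha⟩ := hs X
  have h3 := h.normal_apply a
  simp only at ha
  rw [warped_apply, h1, ha] at h3
  simpa [(hw.radius_pos _ h.mem.1).ne'] using h3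

variable [FiniteDimensional ℝ V] [FiniteDimensional ℝ B] [FiniteDimensional ℝ E]

/-- Turns a condition on a chosen normal into one on the tangent space alone, which can be compared
between charts and normals. -/
theorem normal_fst_eq_zero_iff (hw : IsWarpingData gB ρ γ κ U) (hE : IsMetricOn gE O)
    (hdim : Module.finrank ℝ (B × E) = Module.finrank ℝ V + 1) {y : B × E} (hy : y ∈ U ×ˢ O)
    {T : V →L[ℝ] B × E} (hT : Function.Injective T) {ν : B × E} (hν : warped gB ρ gE y ν ν = 1)
    (hνT : ∀ a, warped gB ρ gE y ν (T a) = 0) :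
    ν.1 = 0 ↔ ∀ b, ∃ a, (T a).1 = b ∧ (T a).2 = 0 := by
  have hν0 : ν ≠ 0 := by
    rintro rfl
    simp at hν
  constructor
  · intro h b
    obtain ⟨a, ha⟩ := (hw.isMetricOn_warped hE).exists_of_normal hdim hy hT hν0 hνT (w := (b, 0))
      (by rw [warped_apply]; simp [h])
    exact ⟨a, by rw [ha], by rw [ha]⟩
  · intro h
    refine hw.metric.eq_of_forall hy.1 fun u => ?_
    obtain ⟨a, h1, h2⟩ := h u
    have h3 := hνT a
    rw [warped_apply, h1, h2] at h3
    simpa using h3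

theorem normal_snd_eq_zero_iff (hw : IsWarpingData gB ρ γ κ U) (hE : IsMetricOn gE O)
    (hdim : Module.finrank ℝ (B × E) = Module.finrank ℝ V + 1) {y : B × E} (hy : y ∈ U ×ˢ O)
    {T : V →L[ℝ] B × E} (hT : Function.Injective T) {ν : B × E} (hν : warped gB ρ gE y ν ν = 1)
    (hνT : ∀ a, warped gB ρ gE y ν (T a) = 0) :
    ν.2 = 0 ↔ ∀ X, ∃ a, (T a).1 = 0 ∧ (T a).2 = X := by
  have hν0 : ν ≠ 0 := by
    rintro rfl
    simp at hν
  constructor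
  · intro h X
    obtain ⟨a, ha⟩ := (hw.isMetricOn_warped hE).exists_of_normal hdim hy hT hν0 hνT (w := (0, X))
      (by rw [warped_apply]; simp [h])
    exact ⟨a, by rw [ha], by rw [ha]⟩
  · intro h
    refine hE.eq_of_forall hy.2 fun u => ?_
    obtain ⟨a, h1, h2⟩ := h u
    have h3 := hνT a
    rw [warped_apply, h1, h2] at h3
    simpa [(hw.radius_pos _ hy.1).ne'] using h3

namespace IsUmbilicPoint

theorem fst_normal_iff (hw : IsWarpingData gB ρ γ κ U) (hE : IsMetricOn gE O)
    (hdim : Module.finrank ℝ (B × E) = Module.finrank ℝ V + 1)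
    (h : IsUmbilicPoint (warped gB ρ gE) (U ×ˢ O) F ν lam x) :
    (ν x).1 = 0 ↔ ∀ b, ∃ a, (fderiv ℝ F x a).1 = b ∧ (fderiv ℝ F x a).2 = 0 :=
  normal_fst_eq_zero_iff hw hE hdim h.mem h.injective h.normal_self h.normal_apply

theorem snd_normal_iff (hw : IsWarpingData gB ρ γ κ U) (hE : IsMetricOn gE O)
    (hdim : Module.finrank ℝ (B × E) = Module.finrank ℝ V + 1)
    (h : IsUmbilicPoint (warped gB ρ gE) (U ×ˢ O) F ν lam x) :
    (ν x).2 = 0 ↔ ∀ X, ∃ a, (fderiv ℝ F x a).1 = 0 ∧ (fderiv ℝ F x a).2 = X :=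
  normal_snd_eq_zero_iff hw hE hdim h.mem h.injective h.normal_self h.normal_apply

/-- If the unit normal is tangent to the fibres, then `λ = 0`. -/
theorem eq_zero_of_fst_normal [Nontrivial B] (hw : IsWarpingData gB ρ γ κ U) (hE : IsMetricOn gE O)
    (hdim : Module.finrank ℝ (B × E) = Module.finrank ℝ V + 1)
    (h : IsUmbilicPoint (warped gB ρ gE) (U ×ˢ O) F ν lam x) (h1 : ∀ᶠ x' in 𝓝 x, (ν x').1 = 0) :
    lam = 0 := by
  have h10 := h1.self_of_nhds
  obtain ⟨b, hb⟩ := exists_ne (0 : B)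
  obtain ⟨a, ha, -⟩ := (h.fst_normal_iff hw hE hdim).1 h10 b
  have h2 := congrArg Prod.fst (h.covDeriv_eq a)
  have hd : DifferentiableAt ℝ ν x := h.contDiffAt_normal.differentiableAt (by simp)
  have h3 : (fderiv ℝ ν x a).1 = 0 := by
    have h4 : (fun x' => (ν x').1) =ᶠ[𝓝 x] fun _ => 0 := h1
    have h5 := hd.hasFDerivAt.fst.unique
      ((hasFDerivAt_const (𝕜 := ℝ) (0 : B) x).congr_of_eventuallyEq h4)
    simpa using congrArg (fun L : V →L[ℝ] B => L a) h5
  have h6 := h.normal_apply a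
  rw [warped_apply, h10] at h6
  have h7 : gE (F x).2 (fderiv ℝ F x a).2 (ν x).2 = 0 := by
    rw [hE.symm _ h.mem.2]
    simpa [(hw.radius_pos _ h.mem.1).ne'] using h6
  -- Every term in the base part of `∇_a ν` vanishes, while the base part of `λ dF a` is `λ b`.
  rw [covDeriv, hw.christoffel_warped hE h.mem, h7, h10, ← christoffelL_apply] at h2
  simp only [Prod.fst_add, h3, map_zero, mul_zero, zero_smul, sub_zero, add_zero, Prod.smul_fst,
    ha] at h2
  exact (smul_eq_zero.1 h2.symm).resolve_right hb

/-- Where the normal is not tangent to the base, a critical point of the radius along the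
hypersurface is a critical point of the radius. -/
theorem fderiv_radius_eq_zero (hw : IsWarpingData gB ρ γ κ U) (hE : IsMetricOn gE O)
    (hpos : ∀ y ∈ O, ∀ X, X ≠ 0 → gE y X X ≠ 0)
    (hdim : Module.finrank ℝ (B × E) = Module.finrank ℝ V + 1)
    (h : IsUmbilicPoint (warped gB ρ gE) (U ×ˢ O) F ν lam x) (h2 : (ν x).2 ≠ 0)
    (hdρ : fderiv ℝ (fun x' => ρ (F x').1) x = 0) : fderiv ℝ ρ (F x).1 = 0 := by
  by_contra hne
  have hγ : γ (F x).1 ≠ 0 := by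
    intro h0
    refine hne (ContinuousLinearMap.ext fun u => ?_)
    rw [← hw.metric_grad _ h.mem.1, h0]; simp
  have hF : DifferentiableAt ℝ F x := h.smooth.differentiableAt (by simp)
  have hchain : HasFDerivAt (fun x' => ρ (F x').1) _ x :=
    (hw.differentiableAt_radius h.mem.1).hasFDerivAt.comp x hF.hasFDerivAt.fst
  rw [hchain.fderiv] at hdρ
  -- If `dρ ≠ 0`, then `(γ, 0)` is a nonzero normal. The vector `(0, ν.2)` is orthogonal to it, so
  -- tangent, so orthogonal to `ν`; this makes `ν.2` null in the fibre.
  obtain ⟨a, ha⟩ := (hw.isMetricOn_warped hE).exists_of_normal hdim h.mem h.injective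
    (ν := (γ (F x).1, 0)) (fun h0 => hγ (congrArg Prod.fst h0)) (fun a => by
      rw [warped_apply]
      simpa [hw.metric_grad _ h.mem.1] using congrArg (fun L : V →L[ℝ] ℝ => L a) hdρ)
    (w := (0, (ν x).2)) (by rw [warped_apply]; simp)
  have h3 := h.normal_apply a
  rw [ha, warped_apply] at h3
  simp only [map_zero, zero_add, mul_eq_zero, pow_eq_zero_iff, ne_eq, OfNat.ofNat_ne_zero,
    not_false_eq_true, (hw.radius_pos _ h.mem.1).ne', false_or] at h3
  exact hpos _ h.mem.2 _ h2 h3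

end IsUmbilicPoint

end Warped

end CoordGeom

/-! ### Local lifts: tangency conditions and their coordinate form -/

section LocalLift

variable {n m : ℕ} {N : Type*} [TopologicalSpace N] [ChartedSpace (EuclideanSpace ℝ (Fin m)) N]
  {P : Type*} [TopologicalSpace P] [ChartedSpace (EuclideanSpace ℝ (Fin n)) P]

/-- The differential of the plane component of `φ`. -/
def planeDeriv (φ : P → (ℝ × ℝ) × N) (q : P) : TangentSpace (𝓡 n) q →L[ℝ] ℝ × ℝ :=
  mfderiv (𝓡 n) 𝓘(ℝ, ℝ × ℝ) (fun q => (φ q).1) q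

/-- The differential of the fibre component of `φ`. -/
def fibreDeriv (φ : P → (ℝ × ℝ) × N) (q : P) :
    TangentSpace (𝓡 n) q →L[ℝ] TangentSpace (𝓡 m) (φ q).2 :=
  mfderiv (𝓡 n) (𝓡 m) (fun q => (φ q).2) q

/-- The lift of the plane is contained in the image of the differential of `φ`. -/
def PlaneTangent (n m : ℕ) {N : Type*} [TopologicalSpace N]
    [ChartedSpace (EuclideanSpace ℝ (Fin m)) N] {P : Type*} [TopologicalSpace P]
    [ChartedSpace (EuclideanSpace ℝ (Fin n)) P] (φ : P → (ℝ × ℝ) × N) (q : P) : Prop :=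
  ∀ b, ∃ v, planeDeriv (n := n) φ q v = b ∧ fibreDeriv (n := n) (m := m) φ q v = 0

/-- The lift of the tangent space of `N` is contained in the image of the differential of `φ`. -/
def FibreTangent (n m : ℕ) {N : Type*} [TopologicalSpace N]
    [ChartedSpace (EuclideanSpace ℝ (Fin m)) N] {P : Type*} [TopologicalSpace P]
    [ChartedSpace (EuclideanSpace ℝ (Fin n)) P] (φ : P → (ℝ × ℝ) × N) (q : P) : Prop :=
  ∀ X, ∃ v, planeDeriv (n := n) φ q v = 0 ∧ fibreDeriv (n := n) (m := m) φ q v = X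

theorem FibreTangent.surjective {φ : P → (ℝ × ℝ) × N} {p : P}
    (hφ : FibreTangent n m φ p) :
    Function.Surjective (fibreDeriv (n := n) (m := m) φ p) := fun X =>
  let ⟨v, hv⟩ := hφ X
  ⟨v, hv.2⟩

/-- `x` is a coordinate near `p` at which the coordinate expression of `φ` is well behaved. -/
structure IsLiftCoord (n m : ℕ) {N : Type*} [TopologicalSpace N]
    [ChartedSpace (EuclideanSpace ℝ (Fin m)) N] {P : Type*} [TopologicalSpace P]
    [ChartedSpace (EuclideanSpace ℝ (Fin n)) P] (φ : P → (ℝ × ℝ) × N) (p : P)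
    (x : EuclideanSpace ℝ (Fin n)) : Prop where
  mem : x ∈ (extChartAt (𝓡 n) p).target
  smooth : ContMDiffAt (𝓡 n) (𝓘(ℝ, ℝ × ℝ).prod (𝓡 m)) ∞ φ ((extChartAt (𝓡 n) p).symm x)
  mem_source : (φ ((extChartAt (𝓡 n) p).symm x)).2 ∈ (extChartAt (𝓡 m) (φ p).2).source

namespace IsLiftCoord

variable {φ : P → (ℝ × ℝ) × N} {p : P} {x : EuclideanSpace ℝ (Fin n)}

theorem contMDiffAt_fst (h : IsLiftCoord n m φ p x) :
    ContMDiffAt (𝓡 n) 𝓘(ℝ, ℝ × ℝ) ∞ (fun q => (φ q).1) ((extChartAt (𝓡 n) p).symm x) :=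
  h.smooth.fst

theorem contMDiffAt_snd (h : IsLiftCoord n m φ p x) :
    ContMDiffAt (𝓡 n) (𝓡 m) ∞ (fun q => (φ q).2) ((extChartAt (𝓡 n) p).symm x) :=
  h.smooth.snd

theorem contMDiffAt_chart [IsManifold (𝓡 m) ∞ N] (h : IsLiftCoord n m φ p x) :
    ContMDiffAt (𝓡 m) 𝓘(ℝ, EuclideanSpace ℝ (Fin m)) ∞ (extChartAt (𝓡 m) (φ p).2)
      (φ ((extChartAt (𝓡 n) p).symm x)).2 :=
  contMDiffAt_extChartAt' (by simpa using h.mem_source)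

theorem bijective_chart [IsManifold (𝓡 m) ∞ N] (h : IsLiftCoord n m φ p x) : Function.Bijective
    (mfderiv (𝓡 m) 𝓘(ℝ, EuclideanSpace ℝ (Fin m)) (extChartAt (𝓡 m) (φ p).2)
        (φ ((extChartAt (𝓡 n) p).symm x)).2) :=
  (isInvertible_mfderiv_extChartAt h.mem_source).bijective

theorem contMDiffAt_chart_snd [IsManifold (𝓡 m) ∞ N] (h : IsLiftCoord n m φ p x) :
    ContMDiffAt (𝓡 n) 𝓘(ℝ, EuclideanSpace ℝ (Fin m)) ∞
      (fun q => extChartAt (𝓡 m) (φ p).2 (φ q).2) ((extChartAt (𝓡 n) p).symm x) :=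
  ContMDiffAt.comp (f := fun q => (φ q).2) _ h.contMDiffAt_chart h.contMDiffAt_snd

variable [IsManifold (𝓡 n) ∞ P]

theorem contMDiffAt_symm (h : IsLiftCoord n m φ p x) :
    ContMDiffAt 𝓘(ℝ, EuclideanSpace ℝ (Fin n)) (𝓡 n) ∞ (extChartAt (𝓡 n) p).symm x :=
  (contMDiffOn_extChartAt_symm p).contMDiffAt ((isOpen_extChartAt_target p).mem_nhds h.mem)

theorem bijective_symm (h : IsLiftCoord n m φ p x) : Function.Bijective
    (mfderiv 𝓘(ℝ, EuclideanSpace ℝ (Fin n)) (𝓡 n) (extChartAt (𝓡 n) p).symm x) :=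
  (FibreMetric.isInvertible_mfderiv_extChartAt_symm p h.mem).bijective

variable [IsManifold (𝓡 m) ∞ N]

theorem contDiffAt_coordMap (h : IsLiftCoord n m φ p x) :
    ContDiffAt ℝ ∞ (coordMap n m φ p) x := by
  have h1 := h.contMDiffAt_fst.comp x h.contMDiffAt_symm
  have h2 := h.contMDiffAt_chart_snd.comp x h.contMDiffAt_symm
  exact h1.contDiffAt.prodMk h2.contDiffAt

theorem fderiv_coordMap_fst (h : IsLiftCoord n m φ p x) (v : EuclideanSpace ℝ (Fin n)) :
    (fderiv ℝ (coordMap n m φ p) x v).1 = planeDeriv φ ((extChartAt (𝓡 n) p).symm x)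
      (mfderiv 𝓘(ℝ, EuclideanSpace ℝ (Fin n)) (𝓡 n) (extChartAt (𝓡 n) p).symm x v) := by
  have hd := h.contDiffAt_coordMap.differentiableAt (by simp)
  have h1 := hd.hasFDerivAt.fst.fderiv
  have h2 := mfderiv_comp x (h.contMDiffAt_fst.mdifferentiableAt (by simp))
    (h.contMDiffAt_symm.mdifferentiableAt (by simp))
  rw [mfderiv_eq_fderiv] at h2
  have h3 := h1.symm.trans h2
  exact congrArg (fun L : EuclideanSpace ℝ (Fin n) →L[ℝ] ℝ × ℝ => L v) h3

theorem fderiv_coordMap_snd (h : IsLiftCoord n m φ p x) (v : EuclideanSpace ℝ (Fin n)) :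
    (fderiv ℝ (coordMap n m φ p) x v).2 =
      mfderiv (𝓡 m) 𝓘(ℝ, EuclideanSpace ℝ (Fin m)) (extChartAt (𝓡 m) (φ p).2)
        (φ ((extChartAt (𝓡 n) p).symm x)).2 (fibreDeriv φ ((extChartAt (𝓡 n) p).symm x)
      (mfderiv 𝓘(ℝ, EuclideanSpace ℝ (Fin n)) (𝓡 n) (extChartAt (𝓡 n) p).symm x v)) := by
  have hd := h.contDiffAt_coordMap.differentiableAt (by simp)
  have h1 := hd.hasFDerivAt.snd.fderiv
  have h2 := mfderiv_comp x
    (h.contMDiffAt_chart_snd.mdifferentiableAt (by simp))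
    (h.contMDiffAt_symm.mdifferentiableAt (by simp))
  rw [mfderiv_eq_fderiv] at h2
  have h3 := h1.symm.trans h2
  have h4 := mfderiv_comp ((extChartAt (𝓡 n) p).symm x) (f := fun q => (φ q).2)
    (h.contMDiffAt_chart.mdifferentiableAt (by simp))
    (h.contMDiffAt_snd.mdifferentiableAt (by simp))
  have h5 := congrArg (fun L : EuclideanSpace ℝ (Fin n) →L[ℝ] EuclideanSpace ℝ (Fin m) => L v) h3
  refine h5.trans ?_
  exact congrArg (fun L : EuclideanSpace ℝ (Fin n) →L[ℝ] EuclideanSpace ℝ (Fin m) =>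
    L (mfderiv 𝓘(ℝ, EuclideanSpace ℝ (Fin n)) (𝓡 n) (extChartAt (𝓡 n) p).symm x v)) h4

/-- The differentials of the charts of `P` and `N` are bijective, so the condition transfers at
every `x` near the centre of the chart. -/
theorem planeTangent_iff (h : IsLiftCoord n m φ p x) :
    PlaneTangent n m φ ((extChartAt (𝓡 n) p).symm x) ↔
      ∀ b, ∃ a, (fderiv ℝ (coordMap n m φ p) x a).1 = b ∧
        (fderiv ℝ (coordMap n m φ p) x a).2 = 0 := by
  refine forall_congr' fun b => h.bijective_symm.2.exists.trans (exists_congr fun a => ?_)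
  exact and_congr (Eq.congr_left (h.fderiv_coordMap_fst a).symm)
    ((map_eq_zero_iff _ h.bijective_chart.1).symm.trans
      (Eq.congr_left (h.fderiv_coordMap_snd a).symm))

theorem fibreTangent_iff (h : IsLiftCoord n m φ p x) :
    FibreTangent n m φ ((extChartAt (𝓡 n) p).symm x) ↔
      ∀ X, ∃ a, (fderiv ℝ (coordMap n m φ p) x a).1 = 0 ∧
        (fderiv ℝ (coordMap n m φ p) x a).2 = X := by
  refine Iff.trans ?_ h.bijective_chart.2.forall.symm
  refine forall_congr' fun X => h.bijective_symm.2.exists.trans (exists_congr fun a => ?_)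
  exact and_congr (Eq.congr_left (h.fderiv_coordMap_fst a).symm)
    (h.bijective_chart.1.eq_iff.symm.trans (Eq.congr_left (h.fderiv_coordMap_snd a).symm))

theorem surjective_fibreDeriv_iff (h : IsLiftCoord n m φ p x) :
    Function.Surjective (fibreDeriv (n := n) (m := m) φ ((extChartAt (𝓡 n) p).symm x)) ↔
      Function.Surjective fun a => (fderiv ℝ (coordMap n m φ p) x a).2 := by
  refine Iff.trans ?_ h.bijective_chart.2.forall.symm
  refine forall_congr' fun X => h.bijective_symm.2.exists.trans (exists_congr fun a => ?_)
  exact h.bijective_chart.1.eq_iff.symm.trans (Eq.congr_left (h.fderiv_coordMap_snd a).symm)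

end IsLiftCoord

end LocalLift

/-! ### The pointwise dichotomy -/

section PhotonSurface

variable {n m : ℕ} {N : Type*} [TopologicalSpace N] [ChartedSpace (EuclideanSpace ℝ (Fin m)) N]
  {P : Type*} [TopologicalSpace P]
  [ChartedSpace (EuclideanSpace ℝ (Fin n)) P]
  {A : BlockAtlas} {f : P → A.Pt × N} {p : P} {i : A.Idx} {φ : P → (ℝ × ℝ) × N}

theorem coordMap_self (φ : P → (ℝ × ℝ) × N) (p : P) :
    coordMap n m φ p (extChartAt (𝓡 n) p p) = ((φ p).1, extChartAt (𝓡 m) (φ p).2 (φ p).2) := by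
  simp only [coordMap, extChartAt_to_inv]

theorem finrank_prod_eq (hnm : n = m + 1) :
    Module.finrank ℝ ((ℝ × ℝ) × EuclideanSpace ℝ (Fin m))
      = Module.finrank ℝ (EuclideanSpace ℝ (Fin n)) + 1 := by
  simp; omega

namespace IsLocalLift

theorem eventually_nhds (hφ : IsLocalLift n m A f p i φ) :
    ∀ᶠ q in 𝓝 p, IsLocalLift n m A f q i φ :=
  eventually_eventually_nhds.2 hφ

theorem tendsto_symm (n : ℕ) {P : Type*} [TopologicalSpace P]
    [ChartedSpace (EuclideanSpace ℝ (Fin n)) P] (p : P) :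
    Filter.Tendsto (extChartAt (𝓡 n) p).symm (𝓝 (extChartAt (𝓡 n) p p)) (𝓝 p) := by
  simpa [ContinuousAt] using continuousAt_extChartAt_symm (I := 𝓡 n) p

theorem eventually_isLiftCoord (hφ : IsLocalLift n m A f p i φ) :
    ∀ᶠ x in 𝓝 (extChartAt (𝓡 n) p p), IsLiftCoord n m φ p x ∧
      coordMap n m φ p x ∈ (A.block i).domain ×ˢ (extChartAt (𝓡 m) (φ p).2).target := by
  have h1 : ∀ᶠ q in 𝓝 p, (φ q).2 ∈ (extChartAt (𝓡 m) (φ p).2).source :=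
    hφ.self_of_nhds.1.snd.continuousAt.eventually_mem
      ((isOpen_extChartAt_source (φ p).2).mem_nhds (mem_extChartAt_source (φ p).2))
  filter_upwards [(tendsto_symm n p).eventually hφ, (tendsto_symm n p).eventually h1,
    (isOpen_extChartAt_target (I := 𝓡 n) p).mem_nhds (mem_extChartAt_target p)] with x h2 h3 h4
  exact ⟨⟨h4, h2.1, h3⟩, h2.2.1, (extChartAt (𝓡 m) (φ p).2).map_source h3⟩

/-- A lift has the same `N`-component as `f`, so this property is independent of block and lift. -/
theorem surjective_fibreDeriv_iff (hφ : IsLocalLift n m A f p i φ) :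
    Function.Surjective (mfderiv (𝓡 n) (𝓡 m) (fun q => (f q).2) p) ↔
      Function.Surjective (fibreDeriv (n := n) (m := m) φ p) := by
  have hev : (fun q => (f q).2) =ᶠ[𝓝 p] fun q => (φ q).2 := by
    filter_upwards [hφ] with q hq
    obtain ⟨hq1, hq2⟩ := hq.2
    rw [hq2]
  have h1 := hev.mfderiv_eq (I := 𝓡 n) (I' := 𝓡 m)
  have h2 : ∀ v : EuclideanSpace ℝ (Fin n), mfderiv (𝓡 n) (𝓡 m) (fun q => (f q).2) p v
      = fibreDeriv (n := n) (m := m) φ p v := fun v =>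
    congrArg (fun L : EuclideanSpace ℝ (Fin n) →L[ℝ] EuclideanSpace ℝ (Fin m) => L v) h1
  exact forall_congr' fun X => exists_congr fun v => Eq.congr_left (h2 v)

end IsLocalLift

/-- The radii at which the Ricci eigenvalue expression does not vanish. -/
def nonvanishingRadii [IsManifold (𝓡 m) ∞ N] (n : ℕ) (gN : FibreMetric m N) (h : ℝ → ℝ) : Set ℝ :=
  {r : ℝ | 0 < r ∧
    ∀ (x : N) (X : TangentSpace (𝓡 m) x), gN.inner x X X = 1 →
      (1 / 2) * iteratedDeriv 2 h r + ((n : ℝ) - 3) / (2 * r) * deriv h r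
        - ((n : ℝ) - 2) / r ^ 2 * h r + (r ^ 2)⁻¹ * gN.ric x X ≠ 0}

variable [IsManifold (𝓡 m) ∞ N] [IsManifold (𝓡 n) ∞ P] {h : ℝ → ℝ} {gN : FibreMetric m N} {lam : ℝ}

theorem IsPhotonSurface.exists_isUmbilicPoint (hnm : n = m + 1)
    (hA : ∀ i, (A.block i).IsAdmissible h) (hf : IsPhotonSurface n A gN f lam)
    (hφ : IsLocalLift n m A f p i φ) :
    ∃ ν, ∀ᶠ x in 𝓝 (extChartAt (𝓡 n) p p), IsLiftCoord n m φ p x ∧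
      IsUmbilicPoint (warped (A.block i).form (A.block i).radius (gN.coord (φ p).2))
        ((A.block i).domain ×ˢ (extChartAt (𝓡 m) (φ p).2).target)
        (coordMap n m φ p) ν lam x := by
  obtain ⟨γ, hw, -, -⟩ := hA i
  obtain ⟨ν, hν⟩ := (hf.2 p i φ hφ).exists_isUmbilicPoint
    (hw.isMetricOn_warped (gN.isMetricOn_coord (φ p).2)) (finrank_prod_eq hnm)
    (hφ.eventually_isLiftCoord.mono fun x hx => ⟨hx.2, hx.1.contDiffAt_coordMap⟩)
  exact ⟨ν, (hφ.eventually_isLiftCoord.and hν).mono fun x hx => ⟨hx.1.1, hx.2⟩⟩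

/-- A point with mixed normal lies at a radius where the Ricci eigenvalue expression vanishes,
unless the radius is critical there. -/
theorem IsPhotonSurface.radius_notMem_of_mixed (hnm : n = m + 1)
    (hh : ContDiffOn ℝ ∞ h (Set.Ioi 0)) (hA : ∀ i, (A.block i).IsAdmissible h)
    (hf : IsPhotonSurface n A gN f lam) (hφ : IsLocalLift n m A f p i φ)
    (h1 : ¬ PlaneTangent n m φ p) (h2 : ¬ FibreTangent n m φ p)
    (hdρ : fderiv ℝ (A.block i).radius (φ p).1 ≠ 0) :
    (A.block i).radius (φ p).1 ∉ nonvanishingRadii n gN h := by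
  obtain ⟨ν, hν⟩ := hf.exists_isUmbilicPoint hnm hA hφ
  obtain ⟨γ, hw, hη, -⟩ := hA i
  have hE := gN.isMetricOn_coord (φ p).2
  have hdim := finrank_prod_eq (n := n) (m := m) hnm
  obtain ⟨hL, hU⟩ := hν.self_of_nhds
  have hP := hL.planeTangent_iff
  have hQ := hL.fibreTangent_iff
  rw [extChartAt_to_inv] at hP hQ
  have hν1 := fun h0 => h1 (hP.2 ((hU.fst_normal_iff hw hE hdim).1 h0))
  have hν2 := fun h0 => h2 (hQ.2 ((hU.snd_normal_iff hw hE hdim).1 h0))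
  have hmem := hU.mem
  have hρpos := hw.radius_pos _ hmem.1
  have hcd : ContDiffAt ℝ ∞ h ((A.block i).radius (φ p).1) := by
    rw [coordMap_self] at hρpos
    exact hh.contDiffAt (Ioi_mem_nhds hρpos)
  have hκ : HasFDerivAt (fun y => deriv h ((A.block i).radius y) / 2)
      ((iteratedDeriv 2 h ((A.block i).radius (φ p).1) / 2) •
        fderiv ℝ (A.block i).radius (φ p).1) (φ p).1 := by
    have hd : HasDerivAt (deriv h) (iteratedDeriv 2 h ((A.block i).radius (φ p).1))
        ((A.block i).radius (φ p).1) := by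
      have hd2 : DifferentiableAt ℝ (deriv h) ((A.block i).radius (φ p).1) := by
        have := (hcd.fderiv_right (m := 1) (by norm_cast)).differentiableAt (by simp)
        exact this.clm_apply (differentiableAt_const (1 : ℝ))
      rw [iteratedDeriv_succ, iteratedDeriv_one]
      exact hd2.hasDerivAt
    have hdr := (hw.differentiableAt_radius hmem.1).hasFDerivAt
    rw [coordMap_self] at hdr
    exact (hd.div_const 2).comp_hasFDerivAt _ hdr
  have key := ricci_of_mixed_normal (κ' := iteratedDeriv 2 h ((A.block i).radius (φ p).1) / 2)
    hw hE hmem (fun X hX => gN.coord_pos _ hmem.2 hX)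
    (by rw [coordMap_self]; exact hκ) (by rw [coordMap_self]; exact hdρ) hν1 hν2
    (fun X Y hX hY => IsUmbilicPoint.riemann_normal
      (hw.isMetricOn_warped hE) hdim (hν.mono fun x hx => hx.2) hX hY)
  have hη' := hη _ hmem.1
  rw [coordMap_self] at key hη' hρpos
  obtain ⟨k1, X, k2, k3⟩ := key
  obtain ⟨Y, k4, k5⟩ := gN.exists_ric_eq (φ p).2 k2
  rintro ⟨-, hgood⟩
  refine hgood (φ p).2 Y k4 ?_
  rw [k5, k3, hη']
  have hn : (n : ℝ) = m + 1 := by rw [hnm]; push_cast; ring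
  simp only at k1 hρpos ⊢
  set r := (A.block i).radius (φ p).1
  -- With `Ric = (n - 2)(h - r h'/2)` inserted, the expression reduces to `h''/2 - h'/(2r)`.
  have k6 : iteratedDeriv 2 h r = deriv h r / r := by
    field_simp
    linarith
  rw [k6, hn]
  field_simp
  ring

/-- At every point the hypersurface is tangent to the plane or to the fibre. -/
theorem IsPhotonSurface.planeTangent_or_fibreTangent (hnm : n = m + 1)
    (hh : ContDiffOn ℝ ∞ h (Set.Ioi 0)) (hA : ∀ i, (A.block i).IsAdmissible h)
    (hRic : RicciEigenvalueCondition n gN h)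
    (hf : IsPhotonSurface n A gN f lam) (hφ : IsLocalLift n m A f p i φ) :
    PlaneTangent n m φ p ∨ FibreTangent n m φ p := by
  by_contra! hcon
  obtain ⟨h1, h2⟩ := hcon
  obtain ⟨ν, hν⟩ := hf.exists_isUmbilicPoint hnm hA hφ
  obtain ⟨γ, hw, hη, hcrit⟩ := hA i
  have hE := gN.isMetricOn_coord (φ p).2
  have hdim := finrank_prod_eq (n := n) (m := m) hnm
  obtain ⟨hL, hU⟩ := hν.self_of_nhds
  have hP := hL.planeTangent_iff
  have hQ := hL.fibreTangent_iff
  rw [extChartAt_to_inv] at hP hQ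
  have hν1 : (ν (extChartAt (𝓡 n) p p)).1 ≠ 0 :=
    fun h0 => h1 (hP.2 ((hU.fst_normal_iff hw hE hdim).1 h0))
  have hν2 : (ν (extChartAt (𝓡 n) p p)).2 ≠ 0 :=
    fun h0 => h2 (hQ.2 ((hU.snd_normal_iff hw hE hdim).1 h0))
  have hc := hU.contDiffAt_normal.continuousAt
  -- Both components of the continuous normal stay nonzero, so every nearby point is mixed.
  have hmix : ∀ᶠ x in 𝓝 (extChartAt (𝓡 n) p p),
      IsUmbilicPoint (warped (A.block i).form (A.block i).radius (gN.coord (φ p).2))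
        ((A.block i).domain ×ˢ (extChartAt (𝓡 m) (φ p).2).target) (coordMap n m φ p) ν lam x ∧
      (ν x).2 ≠ 0 ∧ (fderiv ℝ (A.block i).radius (coordMap n m φ p x).1 ≠ 0 →
        (A.block i).radius (coordMap n m φ p x).1 ∉ nonvanishingRadii n gN h) := by
    filter_upwards [hν, hc.fst.eventually_ne hν1, hc.snd.eventually_ne hν2,
      (IsLocalLift.tendsto_symm n p).eventually hφ.eventually_nhds] with x k1 k2 k3 k4
    refine ⟨k1.2, k3, fun k5 => ?_⟩
    exact hf.radius_notMem_of_mixed hnm hh hA k4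
      (fun h0 => k2 ((k1.2.fst_normal_iff hw hE hdim).2 (k1.1.planeTangent_iff.1 h0)))
      (fun h0 => k3 ((k1.2.snd_normal_iff hw hE hdim).2 (k1.1.fibreTangent_iff.1 h0))) k5
  by_cases hfr : ∀ᶠ x in 𝓝 (extChartAt (𝓡 n) p p),
      fderiv ℝ (A.block i).radius (coordMap n m φ p x).1 = 0
  · have hconst : (fun x => (coordMap n m φ p x).1) =ᶠ[𝓝 (extChartAt (𝓡 n) p p)]
        fun _ => (coordMap n m φ p (extChartAt (𝓡 n) p p)).1 := by
      -- A block has at most one critical point of the radius, so the plane component is locally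
      -- constant, and `hinj` contradicts the dimension count `n = m + 1`.
      filter_upwards [hfr, hmix] with x k1 k2
      exact hcrit _ k2.1.mem.1 _ hU.mem.1 k1 hfr.self_of_nhds
    have hd := (hU.smooth.differentiableAt (by simp)).hasFDerivAt.fst.unique
      ((hasFDerivAt_const (𝕜 := ℝ) _ _).congr_of_eventuallyEq hconst)
    have hinj : Function.Injective
        ((ContinuousLinearMap.snd ℝ (ℝ × ℝ) (EuclideanSpace ℝ (Fin m))).comp
          (fderiv ℝ (coordMap n m φ p) (extChartAt (𝓡 n) p p))) := by
      intro a b hab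
      refine hU.injective (Prod.ext ?_ hab)
      exact (congrArg (fun L : EuclideanSpace ℝ (Fin n) →L[ℝ] ℝ × ℝ => L a) hd).trans
        (congrArg (fun L : EuclideanSpace ℝ (Fin n) →L[ℝ] ℝ × ℝ => L b) hd).symm
    have := LinearMap.finrank_le_finrank_of_injective (f := (((ContinuousLinearMap.snd ℝ (ℝ × ℝ)
      (EuclideanSpace ℝ (Fin m))).comp (fderiv ℝ (coordMap n m φ p) (extChartAt (𝓡 n) p p)) :
        EuclideanSpace ℝ (Fin n) →L[ℝ] EuclideanSpace ℝ (Fin m)) :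
          EuclideanSpace ℝ (Fin n) →ₗ[ℝ] EuclideanSpace ℝ (Fin m))) hinj
    simp at this
    omega
  -- Arbitrarily close to the given point there is one with `dρ ≠ 0` that still has a mixed
  -- neighbourhood.
  · obtain ⟨x, hx0, hx⟩ := (Filter.not_eventually.1 hfr).and_eventually
      (eventually_eventually_nhds.2 hmix) |>.exists
    obtain ⟨hUx, hx2, -⟩ := hx.self_of_nhds
    have hρ := hw.smooth_radius _ hUx.mem.1
    have hu : ContDiffAt ℝ ∞ (fun x => (A.block i).radius (coordMap n m φ p x).1) x :=
      hρ.comp x hUx.smooth.fst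
    have hne : ∀ᶠ x' in 𝓝 x, fderiv ℝ (A.block i).radius (coordMap n m φ p x').1 ≠ 0 := by
      have h3 : ContinuousAt (fderiv ℝ (A.block i).radius) (coordMap n m φ p x).1 :=
        (hρ.fderiv_right (m := 0) (by norm_cast)).continuousAt
      exact (ContinuousAt.comp (f := fun x => (coordMap n m φ p x).1) h3
        hUx.smooth.fst.continuousAt).eventually_ne hx0
    have hsurj : (fderiv ℝ (fun x => (A.block i).radius (coordMap n m φ p x).1) x).range = ⊤ := by
      refine LinearMap.range_eq_top.2 (LinearMap.surjective fun h0 => hx0 ?_)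
      exact hUx.fderiv_radius_eq_zero hw hE
        (fun y hy X hX => (gN.coord_pos _ hy hX).ne') hdim hx2
        (ContinuousLinearMap.coe_injective h0)
    -- A submersion maps neighbourhoods onto neighbourhoods, so an open set of radii misses the
    -- dense set.
    have hmap := (hu.hasStrictFDerivAt (by simp)).map_nhds_eq_of_surj hsurj
    have hbad : ∀ᶠ r in 𝓝 ((A.block i).radius (coordMap n m φ p x).1),
        r ∉ nonvanishingRadii n gN h := by
      rw [← hmap, Filter.eventually_map]
      filter_upwards [hx, hne] with x' k1 k2 using k1.2.2 k2
    have hcl := hRic (hw.radius_pos _ hUx.mem.1)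
    rw [mem_closure_iff_frequently] at hcl
    exact hcl hbad

end PhotonSurface

/-! ### From the dichotomy to the global alternative -/

section PhotonSurface

variable {n m : ℕ} {N : Type*} [TopologicalSpace N] [ChartedSpace (EuclideanSpace ℝ (Fin m)) N]
  [IsManifold (𝓡 m) ∞ N] {P : Type*} [TopologicalSpace P]
  [ChartedSpace (EuclideanSpace ℝ (Fin n)) P] [IsManifold (𝓡 n) ∞ P]
  {A : BlockAtlas} {f : P → A.Pt × N} {p : P} {i : A.Idx} {φ : P → (ℝ × ℝ) × N}
  {h : ℝ → ℝ} {gN : FibreMetric m N} {lam : ℝ}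

/-- With `FibreTangent.surjective`, this makes surjectivity of the fibre differential decide between
the two cases. -/
theorem IsPhotonSurface.not_surjective_of_planeTangent (hnm : n = m + 1)
    (hA : ∀ i, (A.block i).IsAdmissible h) (hf : IsPhotonSurface n A gN f lam)
    (hφ : IsLocalLift n m A f p i φ) (hp : PlaneTangent n m φ p) :
    ¬ Function.Surjective (fibreDeriv (n := n) (m := m) φ p) := by
  obtain ⟨ν, hν⟩ := hf.exists_isUmbilicPoint hnm hA hφ
  obtain ⟨γ, hw, -, -⟩ := hA i
  have hE := gN.isMetricOn_coord (φ p).2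
  obtain ⟨hL, hU⟩ := hν.self_of_nhds
  have hP := hL.planeTangent_iff
  have hS := hL.surjective_fibreDeriv_iff
  rw [extChartAt_to_inv] at hP hS
  rw [hS]
  exact hU.snd_not_surjective hw hE
    ((hU.fst_normal_iff hw hE (finrank_prod_eq hnm)).2 (hP.1 hp))

/-- The tangency type of the hypersurface is locally constant. -/
theorem IsPhotonSurface.isLocallyConstant_surjective (hnm : n = m + 1)
    (hh : ContDiffOn ℝ ∞ h (Set.Ioi 0)) (hA : ∀ i, (A.block i).IsAdmissible h)
    (hRic : RicciEigenvalueCondition n gN h) (hf : IsPhotonSurface n A gN f lam) :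
    IsLocallyConstant fun p : P =>
      Function.Surjective (mfderiv (𝓡 n) (𝓡 m) (fun q => (f q).2) p) := by
  rw [IsLocallyConstant.iff_eventually_eq]
  intro p
  obtain ⟨i, φ, hφ⟩ := hf.1 p
  obtain ⟨ν, hν⟩ := hf.exists_isUmbilicPoint hnm hA hφ
  obtain ⟨γ, hw, -, -⟩ := id hA i
  have hE := gN.isMetricOn_coord (φ p).2
  have hdim := finrank_prod_eq (n := n) (m := m) hnm
  have hchart : Filter.Tendsto (extChartAt (𝓡 n) p) (𝓝 p) (𝓝 (extChartAt (𝓡 n) p p)) :=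
    continuousAt_extChartAt p
  have hsrc : ∀ᶠ q in 𝓝 p, q ∈ (extChartAt (𝓡 n) p).source := extChartAt_source_mem_nhds p
  obtain ⟨hL, hU⟩ := hν.self_of_nhds
  have hP := hL.planeTangent_iff
  have hQ := hL.fibreTangent_iff
  rw [extChartAt_to_inv] at hP hQ
  have hc := hU.contDiffAt_normal.continuousAt
  have hne := hU.normal_ne_zero
  -- In each case the other component of `ν` is nonzero at `p` and remains so nearby, which excludes
  -- the opposite alternative there.
  rcases hf.planeTangent_or_fibreTangent hnm hh hA hRic hφ with hp | hp
  · have hν1 := (hU.fst_normal_iff hw hE hdim).2 (hP.1 hp)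
    have hν2 : (ν (extChartAt (𝓡 n) p p)).2 ≠ 0 := fun h0 => hne (Prod.ext hν1 h0)
    filter_upwards [hφ.eventually_nhds, hsrc, hchart.eventually hν,
      hchart.eventually (hc.snd.eventually_ne hν2)] with q k1 k2 k3 k4
    have hQ' := k3.1.fibreTangent_iff
    rw [(extChartAt (𝓡 n) p).left_inv k2] at hQ'
    have hq := (hf.planeTangent_or_fibreTangent hnm hh hA hRic k1).resolve_right
      fun h0 => k4 ((k3.2.snd_normal_iff hw hE hdim).2 (hQ'.1 h0))
    rw [eq_iff_iff, k1.surjective_fibreDeriv_iff, hφ.surjective_fibreDeriv_iff]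
    exact iff_of_false (hf.not_surjective_of_planeTangent hnm hA k1 hq)
      (hf.not_surjective_of_planeTangent hnm hA hφ hp)
  · have hν2 := (hU.snd_normal_iff hw hE hdim).2 (hQ.1 hp)
    have hν1 : (ν (extChartAt (𝓡 n) p p)).1 ≠ 0 := fun h0 => hne (Prod.ext h0 hν2)
    filter_upwards [hφ.eventually_nhds, hsrc, hchart.eventually hν,
      hchart.eventually (hc.fst.eventually_ne hν1)] with q k1 k2 k3 k4
    have hP' := k3.1.planeTangent_iff
    rw [(extChartAt (𝓡 n) p).left_inv k2] at hP'
    have hq := (hf.planeTangent_or_fibreTangent hnm hh hA hRic k1).resolve_left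
      fun h0 => k4 ((k3.2.fst_normal_iff hw hE hdim).2 (hP'.1 h0))
    rw [eq_iff_iff, k1.surjective_fibreDeriv_iff, hφ.surjective_fibreDeriv_iff]
    exact iff_of_true hq.surjective hp.surjective

/-- The rigidity of photon surfaces with constant umbilicity factor, for spacetimes covered by
admissible blocks. -/
theorem IsPhotonSurface.isRotationallySymmetric_or [ConnectedSpace P] (hnm : n = m + 1)
    (hh : ContDiffOn ℝ ∞ h (Set.Ioi 0)) (hA : ∀ i, (A.block i).IsAdmissible h)
    (hRic : RicciEigenvalueCondition n gN h) (hf : IsPhotonSurface n A gN f lam) :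
    IsRotationallySymmetric n A gN f ∨ IsTotallyGeodesicFibreNormal n A gN f := by
  have hconst := hf.isLocallyConstant_surjective hnm hh hA hRic
  have hdim := finrank_prod_eq (n := n) (m := m) hnm
  by_cases hS : ∀ p : P, Function.Surjective (mfderiv (𝓡 n) (𝓡 m) (fun q => (f q).2) p)
  · left
    intro p i φ hφ
    have hp : FibreTangent n m φ p :=
      (hf.planeTangent_or_fibreTangent hnm hh hA hRic hφ).resolve_left fun h0 =>
        hf.not_surjective_of_planeTangent hnm hA hφ h0 (hφ.surjective_fibreDeriv_iff.1 (hS p))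
    obtain ⟨ν, hν⟩ := hf.exists_isUmbilicPoint hnm hA hφ
    obtain ⟨γ, hw, -, -⟩ := id hA i
    have hE := gN.isMetricOn_coord (φ p).2
    obtain ⟨hL, hU⟩ := hν.self_of_nhds
    have hQ := hL.fibreTangent_iff
    rw [extChartAt_to_inv] at hQ
    refine ⟨fun X => ?_, fun ν' hν' => ?_⟩
    · obtain ⟨a, h1, h2⟩ := hQ.1 hp X
      exact ⟨a, Prod.ext h1 h2⟩
    · have h0 := hν'.self_of_nhds
      exact (normal_snd_eq_zero_iff hw hE hdim hU.mem hU.injective h0.2.2 h0.2.1).2 (hQ.1 hp)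
  · right
    have hS' : ∀ p : P, ¬ Function.Surjective (mfderiv (𝓡 n) (𝓡 m) (fun q => (f q).2) p) := by
      push Not at hS
      obtain ⟨p₀, hp₀⟩ := hS
      intro p
      have := hconst.apply_eq_of_preconnectedSpace p p₀
      simp only [eq_iff_iff] at this
      rwa [this]
    have hplane : ∀ (p : P) (i : A.Idx) (φ : P → (ℝ × ℝ) × N), IsLocalLift n m A f p i φ →
        PlaneTangent n m φ p := fun p i φ hφ =>
      (hf.planeTangent_or_fibreTangent hnm hh hA hRic hφ).resolve_right fun h0 =>
        hS' p (hφ.surjective_fibreDeriv_iff.2 h0.surjective)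
    intro p i φ hφ
    obtain ⟨ν, hν⟩ := hf.exists_isUmbilicPoint hnm hA hφ
    obtain ⟨γ, hw, -, -⟩ := id hA i
    have hE := gN.isMetricOn_coord (φ p).2
    obtain ⟨hL, hU⟩ := hν.self_of_nhds
    have hP := hL.planeTangent_iff
    rw [extChartAt_to_inv] at hP
    -- The base part must vanish on a neighbourhood, since its derivative enters the proof that `λ =
    -- 0`.
    have hν1 : ∀ᶠ x in 𝓝 (extChartAt (𝓡 n) p p), (ν x).1 = 0 := by
      filter_upwards [hν, (IsLocalLift.tendsto_symm n p).eventually hφ.eventually_nhds]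
        with x k1 k2
      exact (k1.2.fst_normal_iff hw hE hdim).2 (k1.1.planeTangent_iff.1 (hplane _ i φ k2))
    obtain rfl : lam = 0 := hU.eq_zero_of_fst_normal hw hE hdim hν1
    intro x₀ F G ν' hν'
    obtain ⟨h1, h2⟩ := hU.totallyGeodesic (hw.isMetricOn_warped hE) hdim hν'
    have h0 := hν'.self_of_nhds
    exact ⟨h1, h2, (normal_fst_eq_zero_iff hw hE hdim hU.mem hU.injective h0.2.2 h0.2.1).2
      (hP.1 (hplane p i φ hφ))⟩

end PhotonSurface

end

theorem theorem5p1 (n : ℕ) (hn : 3 ≤ n)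
    {N : Type*} [TopologicalSpace N] [T2Space N] [CompactSpace N]
    [ChartedSpace (EuclideanSpace ℝ (Fin (n - 1))) N] [IsManifold (𝓡 (n - 1)) ∞ N]
    (gN : FibreMetric (n - 1) N) (h : ℝ → ℝ) (rH : ℝ) (hh : IsMetricCoefficient h rH)
    (hRic : RicciEigenvalueCondition n gN h)
    {P : Type*} [TopologicalSpace P] [ConnectedSpace P]
    [ChartedSpace (EuclideanSpace ℝ (Fin n)) P] [IsManifold (𝓡 n) ∞ P] (lam : ℝ) :
    (∀ f : P → (staticAtlas h rH).Pt × N,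
      IsPhotonSurface n (staticAtlas h rH) gN f lam →
        IsRotationallySymmetric n (staticAtlas h rH) gN f ∨
        IsTotallyGeodesicFibreNormal n (staticAtlas h rH) gN f) ∧
    (HasSimpleHorizons h → ∀ (K : KruskalGluing h) (f : P → K.atlas.Pt × N),
      IsPhotonSurface n K.atlas gN f lam →
        IsRotationallySymmetric n K.atlas gN f ∨
        IsTotallyGeodesicFibreNormal n K.atlas gN f) := by
  -- The fibre dimension `n - 1` is a truncated subtraction; `3 ≤ n` makes it genuine.
  have hnm : n = n - 1 + 1 := by omega
  refine ⟨fun f hf => hf.isRotationallySymmetric_or hnm hh.smooth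
    (fun _ => staticBlock_isAdmissible hh) hRic, fun hS K f hf => ?_⟩
  exact hf.isRotationallySymmetric_or hnm hh.smooth (fun a => kruskalBlock_isAdmissible hh.smooth hS
    (K.horizon_pos a) (K.horizon_root a) (K.potential_spec a)) hRic
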